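/- Theorem 1.1. Let $M$ be a closed (compact, without boundary) connected 3-manifold with a (simplicial) triangulation $\mathcal T$, with vertex set $V$, $|V|=N$, and set of tetrahedra $\mathcal T_3$. Let $\mathcal M_{\mathcal T}\subset\mathbb R_{>0}^N$ be the set of (real) ball packings, i.e. of all $r=(r_i)_{i\in V}$ with $r_i>0$ such that for every $\{ijkl\}\in\mathcal T_3$ there is a nondegenerate Euclidean tetrahedron whose edge between the vertices $a,b\in\{i,j,k,l\}$ has length $r_a+r_b$. For $r\in\mathcal M_{\mathcal T}$ let $\alpha_{ijkl}$ be the solid angle at the vertex $i$ of that tetrahedron, let $$K_i=4\pi-\sum_{\{ijkl\}\in\mathcal T_3}\alpha_{ijkl}$$ (sum over the tetrahedra that have $i$ as a vertex) be the Cooper–Rivin combinatorial scalar curvature at $i$, and let $$\lambda(r)=\frac{\sum_{i\in V}K_ir_i}{\sum_{i\in V}r_i},\qquad Y_{\mathcal T}=\inf_{r\in\mathcal M_{\mathcal T}}\lambda(r)$$ be the Cooper–Rivin–Glickenstein functional and the combinatorial Yamabe invariant. The set $\mathcal M_{\mathcal T}$ is nonempty and $Y_{\mathcal T}$ is finite.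 The following are equivalent: 1. there is $r\in\mathcal M_{\mathcal T}$ with constant curvature, i.e. $K_i(r)=K_j(r)$ for all $i,j\in V$; 2. $Y_{\mathcal T}$ is attained, i.e. $\lambda(r)=Y_{\mathcal T}$ for some $r\in\mathcal M_{\mathcal T}$; equivalently, $\lambda$ has a global minimum in $\mathcal M_{\mathcal T}$; 3. $\lambda$ has a local minimum in $\mathcal M_{\mathcal T}$; 4. $\lambda$ has a critical point in $\mathcal M_{\mathcal T}$. Moreover, if $\hat r\in\mathcal M_{\mathcal T}$ has constant curvature, then $\lambda(\hat r)=Y_{\mathcal T}$, and the global minimum points of $\lambda$ in $\mathcal M_{\mathcal T}$ are exactly the packings $c\hat r$ with $c>0$; in particular, the constant curvature packing is unique up to scaling. -/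

import Mathlib

noncomputable section

/-- Euclidean three-space. -/
abbrev E3 : Type := EuclideanSpace ℝ (Fin 3)

/-- The geometric realization of the simplicial complex on the vertex set `V` whose simplices are
the nonempty subsets of the members of `tets`: a point is given by its barycentric coordinates,
and these are supported in one of the members of `tets`. -/
def geomRealization {V : Type*} [Fintype V] (tets : Finset (Finset V)) : Set (V → ℝ) :=
  {x | (∀ v, 0 ≤ x v) ∧ ∑ v, x v = 1 ∧ ∃ τ ∈ tets, ∀ v, v ∉ τ → x v = 0}

/-- A triangulation of the space `M`, i.e. a decomposition of `M` into tetrahedra in the sense of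
simplicial complexes: a finite vertex set `V`, a set of tetrahedra (four-element sets of vertices;
edges and triangles are the faces of the tetrahedra) in which every vertex occurs, and a
homeomorphism from the geometric realization onto `M`. -/
structure Triangulation (M : Type*) [TopologicalSpace M] (V : Type*) [Fintype V] where
  /-- the tetrahedra -/
  tets : Finset (Finset V)
  card_tet : ∀ τ ∈ tets, τ.card = 4
  exists_tet : ∀ v : V, ∃ τ ∈ tets, v ∈ τ
  /-- the identification of the geometric realization with `M` -/
  homeo : geomRealization tets ≃ₜ M

section Tetrahedron

variable {V : Type*}

/-- The points `p j`, `j ∈ τ`, are the vertices of a nondegenerate Euclidean simplex in which the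
edge between the vertices `j` and `k` has length `r j + r k`. -/
def IsRealization (τ : Finset V) (r : V → ℝ) (p : V → E3) : Prop :=
  AffineIndependent ℝ (fun j : τ => p j) ∧
    ∀ j ∈ τ, ∀ k ∈ τ, j ≠ k → dist (p j) (p k) = r j + r k

/-- The infinite cone (translated to the origin) spanned at the vertex `p i` by the simplex with
vertices `p j`, `j ∈ τ`. -/
def vertexCone (τ : Finset V) (p : V → E3) (i : V) : Set E3 :=
  {x | ∃ c : V → ℝ, (∀ j, 0 ≤ c j) ∧ x = ∑ j ∈ τ, c j • (p j - p i)}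

/-- The solid angle at the vertex `p i` of the simplex with vertices `p j`, `j ∈ τ`: the area of
the part of the unit sphere that lies in the cone spanned at `p i`. -/
def solidAngleAt (τ : Finset V) (p : V → E3) (i : V) : ℝ :=
  (MeasureTheory.volume : MeasureTheory.Measure E3).toSphere.real
    {u : Metric.sphere (0 : E3) 1 | (u : E3) ∈ vertexCone τ p i}

open Classical in
/-- The solid angle at the vertex `i` of the Euclidean tetrahedron `τ` with edge lengths
`r j + r k`. That tetrahedron is unique up to isometry, so any realization can be used; the value
`0` is assigned if there is none. -/
def solidAngle (τ : Finset V) (r : V → ℝ) (i : V) : ℝ :=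
  if h : ∃ p : V → E3, IsRealization τ r p then solidAngleAt τ h.choose i else 0

end Tetrahedron

namespace Triangulation

variable {M : Type*} [TopologicalSpace M] {V : Type*} [Fintype V]

/-- The space of (real) ball packings: positive radii such that each tetrahedron of the
triangulation, with edge lengths `r j + r k`, is realized by a nondegenerate Euclidean
tetrahedron. -/
def ballPackings (T : Triangulation M V) : Set (V → ℝ) :=
  {r | (∀ i, 0 < r i) ∧ ∀ τ ∈ T.tets, ∃ p : V → E3, IsRealization τ r p}

open Classical in
/-- The combinatorial scalar curvature of Cooper and Rivin at the vertex `i`. -/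
def curvature (T : Triangulation M V) (r : V → ℝ) (i : V) : ℝ :=
  4 * Real.pi - ∑ τ ∈ T.tets with i ∈ τ, solidAngle τ r i

/-- The packing `r` has constant combinatorial scalar curvature. -/
def HasConstantCurvature (T : Triangulation M V) (r : V → ℝ) : Prop :=
  ∃ c : ℝ, ∀ i, T.curvature r i = c

/-- The Cooper–Rivin–Glickenstein functional. It is meant for `r ∈ T.ballPackings`. -/
def crg (T : Triangulation M V) (r : V → ℝ) : ℝ :=
  (∑ i, T.curvature r i * r i) / ∑ i, r i

/-- The combinatorial Yamabe invariant. -/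
def yamabeInvariant (T : Triangulation M V) : ℝ :=
  sInf (T.crg '' T.ballPackings)

end Triangulation

end

/-! The heart is a monotonicity property of one tetrahedron: for two realizable vectors of radii,
the sum of `(α' i - α i) * (r' i - r i)` is at most zero, and it vanishes only if the radii are
proportional.

Put `k = r⁻¹` and let `Q` be the Descartes form of `k`. The tetrahedron exists exactly when `Q > 0`,
and then its dihedral angles are sums of two face angles `arctan (faceSum k j / √Q)`. By Girard's
theorem the solid angles are linear in the four face angles (`solidAngle_eq_vertexAngle`). Their
derivative is `-2 / √Q` times the symmetric form `angleForm`, which is positive semidefinite with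
kernel spanned by `k` (`angleForm_nonneg`, `eq_smul_of_angleForm_self_eq_zero`). That `k` lies in
the kernel is the Schläfli formula.

The realizable radii need not form a convex set, so the segment between two of them may leave it.
The face angles therefore have a continuous extension to all positive radii, which takes only the
values `π / 2` and `-π / 2` where `Q ≤ 0`. Along a segment the relevant sum does not increase where
`Q > 0` and has finitely many values elsewhere, so it is antitone
(`antitoneOn_sum_vertexAngle_mul`).

Summed over the tetrahedra, this makes the curvature `K` a monotone map. Let `K` be a constant `c`
at `r`. Compare any `r'` with `s • r`, which has the same curvature, and let `s` tend to zero: the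
result is `∑ (K' i - c) * r' i ≥ 0`, so `r` is a global minimum. Conversely, by Schläfli the
derivative of `∑ K i * r i` in the direction `v` is `∑ K i * v i`, so at a critical point every `K
i` equals the value of the functional. Two minima have the same constant curvature, hence are
proportional on each tetrahedron, and connectedness of the space makes the factor global. -/

noncomputable section

/-! ### The symmetric form behind the variation of the solid angles -/

/-- The sum of the `k i`, with the sign of `k j` reversed. -/
def faceSum (k : Fin 4 → ℝ) (j : Fin 4) : ℝ := ∑ i, k i - 2 * k j

/-- The Descartes quadratic form. -/
def descartes (k : Fin 4 → ℝ) : ℝ := (∑ i, k i) ^ 2 - 2 * ∑ i, k i ^ 2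

/-- The terms with `k j` cancel, which leaves four times the second elementary symmetric polynomial
of the other three entries. Positivity holds without `0 < descartes k`; this lets the face angles
extend beyond the realizable radii. -/
lemma descartes_add_faceSum_sq_pos {k : Fin 4 → ℝ} (hk : ∀ i, 0 < k i) (j : Fin 4) :
    0 < descartes k + faceSum k j ^ 2 := by
  have h0 := hk 0
  have h1 := hk 1
  have h2 := hk 2
  have h3 := hk 3
  simp only [descartes, faceSum, Fin.sum_univ_four]
  fin_cases j <;> simp only [Fin.zero_eta, Fin.mk_one, Fin.reduceFinMk]
  · have : 0 < 4 * (k 1 * k 2 + k 1 * k 3 + k 2 * k 3) := by positivity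
    linarith
  · have : 0 < 4 * (k 0 * k 2 + k 0 * k 3 + k 2 * k 3) := by positivity
    linarith
  · have : 0 < 4 * (k 0 * k 1 + k 0 * k 3 + k 1 * k 3) := by positivity
    linarith
  · have : 0 < 4 * (k 0 * k 1 + k 0 * k 2 + k 1 * k 2) := by positivity
    linarith

/-- Half of the derivative of the Descartes form at `k` in the direction `z`. -/
def descartesPolar (k z : Fin 4 → ℝ) : ℝ := ∑ j, faceSum k j * z j

/-- The derivative, up to the factor `√(descartes k)`, of the angle `faceAngle k j` in the
direction `z`. -/
def faceAngleVariation (k z : Fin 4 → ℝ) (j : Fin 4) : ℝ :=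
  (descartes k * faceSum z j - faceSum k j * descartesPolar k z) /
    (descartes k + faceSum k j ^ 2)

/-- The bilinear form, in the variations of the inverse radii, that is given by the derivative
of the solid angles. -/
def angleForm (k z w : Fin 4 → ℝ) : ℝ :=
  ∑ j, faceAngleVariation k z j * (∑ i, w i / k i ^ 2 - w j / k j ^ 2)

/-- This is the symmetry of the Jacobian of the solid angles. Both the Schläfli formula and the
semidefiniteness argument rest on it. -/
lemma angleForm_comm {k : Fin 4 → ℝ} (hk : ∀ i, 0 < k i) (z w : Fin 4 → ℝ) :
    angleForm k z w = angleForm k w z := by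
  have h0 := hk 0
  have h1 := hk 1
  have h2 := hk 2
  have h3 := hk 3
  have e0 : descartes k + faceSum k 0 ^ 2 = 4 * (k 1 * k 2 + k 1 * k 3 + k 2 * k 3) := by
    simp only [descartes, faceSum, Fin.sum_univ_four]; ring
  have e1 : descartes k + faceSum k 1 ^ 2 = 4 * (k 0 * k 2 + k 0 * k 3 + k 2 * k 3) := by
    simp only [descartes, faceSum, Fin.sum_univ_four]; ring
  have e2 : descartes k + faceSum k 2 ^ 2 = 4 * (k 0 * k 1 + k 0 * k 3 + k 1 * k 3) := by
    simp only [descartes, faceSum, Fin.sum_univ_four]; ring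
  have e3 : descartes k + faceSum k 3 ^ 2 = 4 * (k 0 * k 1 + k 0 * k 2 + k 1 * k 2) := by
    simp only [descartes, faceSum, Fin.sum_univ_four]; ring
  -- each variation is linear in `z`; the fractions simplify before they are compared
  have key : ∀ z,
      faceAngleVariation k z 0 = faceSum z 0 - faceSum k 0 *
        ((k 2 + k 3) * z 1 + (k 1 + k 3) * z 2 + (k 1 + k 2) * z 3) /
          (2 * (k 1 * k 2 + k 1 * k 3 + k 2 * k 3)) ∧
      faceAngleVariation k z 1 = faceSum z 1 - faceSum k 1 *
        ((k 2 + k 3) * z 0 + (k 0 + k 3) * z 2 + (k 0 + k 2) * z 3) /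
          (2 * (k 0 * k 2 + k 0 * k 3 + k 2 * k 3)) ∧
      faceAngleVariation k z 2 = faceSum z 2 - faceSum k 2 *
        ((k 1 + k 3) * z 0 + (k 0 + k 3) * z 1 + (k 0 + k 1) * z 3) /
          (2 * (k 0 * k 1 + k 0 * k 3 + k 1 * k 3)) ∧
      faceAngleVariation k z 3 = faceSum z 3 - faceSum k 3 *
        ((k 1 + k 2) * z 0 + (k 0 + k 2) * z 1 + (k 0 + k 1) * z 2) /
          (2 * (k 0 * k 1 + k 0 * k 2 + k 1 * k 2)) := by
    intro z
    simp only [faceAngleVariation, e0, e1, e2, e3]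
    refine ⟨?_, ?_, ?_, ?_⟩
    all_goals
      field_simp
      simp only [descartes, faceSum, descartesPolar, Fin.sum_univ_four]
      ring
  obtain ⟨z0, z1, z2, z3⟩ := key z
  obtain ⟨w0, w1, w2, w3⟩ := key w
  simp only [angleForm, Fin.sum_univ_four, z0, z1, z2, z3, w0, w1, w2, w3]
  simp only [faceSum, Fin.sum_univ_four]
  field_simp
  ring

end

/-! ### Semidefiniteness of the form and its kernel -/

noncomputable section

open Set Filter Topology

lemma descartesPolar_self (k : Fin 4 → ℝ) : descartesPolar k k = descartes k := by
  simp only [descartesPolar, descartes, faceSum, Fin.sum_univ_four]; ring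

/-- Angles do not change under scaling, so the direction `k` has no effect to first order. -/
lemma angleForm_self_left (k w : Fin 4 → ℝ) : angleForm k k w = 0 := by
  have : ∀ j, faceAngleVariation k k j = 0 := fun j => by
    rw [faceAngleVariation, descartesPolar_self, mul_comm, sub_self, zero_div]
  simp [angleForm, this]

/-- Testing with multiples of the unit vectors shows that each variation equals the sum of all four;
adding these equations makes the sum, hence every variation, zero. Then `faceSum z` is a multiple of
`faceSum k`, and `faceSum` is an invertible linear map. -/
lemma eq_smul_of_angleForm_eq_zero {k : Fin 4 → ℝ} (hk : ∀ i, 0 < k i) (hQ : 0 < descartes k)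
    {z : Fin 4 → ℝ} (h : ∀ w, angleForm k z w = 0) : ∃ c : ℝ, z = c • k := by
  have hD : ∀ i, ∑ j, faceAngleVariation k z j - faceAngleVariation k z i = 0 := by
    intro i
    have := h (fun m => if m = i then k i ^ 2 else 0)
    have hi := (hk i).ne'
    rw [← this, angleForm]
    have h1 : ∀ j, ((if j = i then k i ^ 2 else 0) / k j ^ 2 : ℝ) = if j = i then 1 else 0 := by
      intro j
      by_cases hj : j = i
      · subst hj; simp [hi]
      · simp [hj]
    simp only [h1, Finset.sum_ite_eq', Finset.mem_univ, if_true, mul_sub, mul_one,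
      Finset.sum_sub_distrib, mul_ite, mul_zero]
  have hS : ∑ j, faceAngleVariation k z j = 0 := by
    have h0 := hD 0
    have h1 := hD 1
    have h2 := hD 2
    have h3 := hD 3
    simp only [Fin.sum_univ_four] at *
    linarith
  have hZ : ∀ j, descartes k * faceSum z j - faceSum k j * descartesPolar k z = 0 := by
    intro j
    have hj : faceAngleVariation k z j = 0 := by have := hD j; linarith
    rw [faceAngleVariation, div_eq_zero_iff] at hj
    exact hj.resolve_right (descartes_add_faceSum_sq_pos hk j).ne'
  refine ⟨descartesPolar k z / descartes k, funext fun i => ?_⟩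
  rw [Pi.smul_apply, smul_eq_mul, div_mul_eq_mul_div, eq_div_iff hQ.ne']
  have h0 := hZ 0
  have h1 := hZ 1
  have h2 := hZ 2
  have h3 := hZ 3
  generalize descartesPolar k z = s at *
  generalize descartes k = Q at *
  simp only [faceSum, Fin.sum_univ_four] at *
  fin_cases i <;> simp only [Fin.zero_eta, Fin.mk_one, Fin.reduceFinMk] <;> linarith

lemma faceSum_add_smul (z w : Fin 4 → ℝ) (ε : ℝ) (j : Fin 4) :
    faceSum (z + ε • w) j = faceSum z j + ε * faceSum w j := by
  simp only [faceSum, Fin.sum_univ_four, Pi.add_apply, Pi.smul_apply, smul_eq_mul]; ring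

lemma faceAngleVariation_add_smul (k z w : Fin 4 → ℝ) (ε : ℝ) (j : Fin 4) :
    faceAngleVariation k (z + ε • w) j =
      faceAngleVariation k z j + ε * faceAngleVariation k w j := by
  have : descartesPolar k (z + ε • w) = descartesPolar k z + ε * descartesPolar k w := by
    simp only [descartesPolar, Pi.add_apply, Pi.smul_apply, smul_eq_mul, mul_add,
      Finset.sum_add_distrib, Finset.mul_sum]
    congr 1
    exact Finset.sum_congr rfl fun _ _ => by ring
  rw [faceAngleVariation, faceSum_add_smul, this, faceAngleVariation, faceAngleVariation]
  ring

lemma angleForm_add_smul_left (k z z' w : Fin 4 → ℝ) (ε : ℝ) :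
    angleForm k (z + ε • z') w = angleForm k z w + ε * angleForm k z' w := by
  simp only [angleForm, faceAngleVariation_add_smul, Finset.mul_sum, ← Finset.sum_add_distrib]
  exact Finset.sum_congr rfl fun _ _ => by ring

lemma angleForm_add_smul_right {k : Fin 4 → ℝ} (hk : ∀ i, 0 < k i) (z w w' : Fin 4 → ℝ) (ε : ℝ) :
    angleForm k z (w + ε • w') = angleForm k z w + ε * angleForm k z w' := by
  simp only [angleForm_comm hk z, angleForm_add_smul_left]

/-- A quadratic polynomial that is nonnegative and vanishes at `0` has no linear term. -/
lemma eq_zero_of_forall_quadratic_nonneg {b c : ℝ} (h : ∀ ε : ℝ, 0 ≤ 2 * ε * b + ε ^ 2 * c) :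
    b = 0 := by
  have hc : 0 ≤ c := by have h1 := h 1; have h2 := h (-1); nlinarith
  -- The minimizer would be `-b / c`; the shift keeps the denominator positive when `c = 0`.
  have := h (-b / (c + 1))
  have h3 : 2 * (-b / (c + 1)) * b + (-b / (c + 1)) ^ 2 * c = -(b ^ 2 * (c + 2)) / (c + 1) ^ 2 := by
    field_simp; ring
  rw [h3, le_div_iff₀ (by positivity), zero_mul] at this
  have h4 : 0 ≤ b ^ 2 * (c + 2) := by positivity
  have h5 : b ^ 2 * (c + 2) = 0 := by linarith
  have h6 : b ^ 2 = 0 := by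
    rcases mul_eq_zero.mp h5 with h | h
    · exact h
    · linarith
  exact pow_eq_zero_iff (two_ne_zero) |>.mp h6

lemma angleForm_one_self (z : Fin 4 → ℝ) :
    angleForm (fun _ => 1) z z = (4 * ∑ i, z i ^ 2 - (∑ i, z i) ^ 2) * (1 / 3) := by
  simp only [angleForm, faceAngleVariation, descartes, descartesPolar, faceSum, Fin.sum_univ_four]
  ring

/-- The Descartes form is positive along the segment from a point of the positive cone to
`(1, 1, 1, 1)`. -/
lemma descartes_segment_pos {k : Fin 4 → ℝ} (hk : ∀ i, 0 < k i) (hQ : 0 < descartes k)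
    {t : ℝ} (h0 : 0 ≤ t) (h1 : t ≤ 1) : 0 < descartes (fun i => 1 + t * (k i - 1)) := by
  have e : descartes (fun i => 1 + t * (k i - 1)) =
      t ^ 2 * descartes k + 4 * (1 - t) * t * (∑ i, k i) + 8 * (1 - t) ^ 2 := by
    simp only [descartes, Fin.sum_univ_four]; ring
  have hs : 0 < ∑ i, k i := Finset.sum_pos (fun i _ => hk i) Finset.univ_nonempty
  rw [e]
  rcases eq_or_lt_of_le h1 with rfl | h1
  · simpa using hQ
  · have := sub_pos.mpr h1
    have h2 : 0 ≤ t ^ 2 * descartes k := by positivity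
    have h3 : 0 ≤ 4 * (1 - t) * t * (∑ i, k i) := by positivity
    have h4 : 0 < 8 * (1 - t) ^ 2 := by positivity
    linarith

/-- The form `angleForm`, made definite in the direction of the radii. -/
def definiteForm (k z : Fin 4 → ℝ) : ℝ := angleForm k z z + (∑ i, k i * z i) ^ 2

lemma sum_mul_add_smul (k z w : Fin 4 → ℝ) (ε : ℝ) :
    ∑ i, k i * (z + ε • w) i = ∑ i, k i * z i + ε * ∑ i, k i * w i := by
  simp only [Fin.sum_univ_four, Pi.add_apply, Pi.smul_apply, smul_eq_mul]; ring

lemma definiteForm_add_smul {k : Fin 4 → ℝ} (hk : ∀ i, 0 < k i) (z w : Fin 4 → ℝ) (ε : ℝ) :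
    definiteForm k (z + ε • w) = definiteForm k z +
      2 * ε * (angleForm k z w + (∑ i, k i * z i) * ∑ i, k i * w i) +
        ε ^ 2 * definiteForm k w := by
  simp only [definiteForm, sum_mul_add_smul, angleForm_add_smul_left, angleForm_add_smul_right hk,
    angleForm_comm hk w z]
  ring

lemma angleForm_zero_left (k w : Fin 4 → ℝ) : angleForm k 0 w = 0 := by
  simp [angleForm, faceAngleVariation, faceSum, descartesPolar]

lemma definiteForm_zero (k : Fin 4 → ℝ) : definiteForm k 0 = 0 := by
  simp [definiteForm, angleForm_zero_left]

lemma definiteForm_smul {k : Fin 4 → ℝ} (hk : ∀ i, 0 < k i) (z : Fin 4 → ℝ) (c : ℝ) :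
    definiteForm k (c • z) = c ^ 2 * definiteForm k z := by
  simpa [angleForm_zero_left, definiteForm_zero] using definiteForm_add_smul hk 0 z c

lemma sum_mul_self_pos {k : Fin 4 → ℝ} (hk : ∀ i, 0 < k i) : 0 < ∑ i, k i * k i :=
  Finset.sum_pos (fun i _ => mul_pos (hk i) (hk i)) Finset.univ_nonempty

/-- A null vector of a semidefinite form lies in its radical. Pairing with `k`, which is in the
kernel of `angleForm`, shows that `z` is orthogonal to `k`; hence `z` is in that kernel too, so a
multiple of `k`, so zero. -/
lemma eq_zero_of_definiteForm_eq_zero {k : Fin 4 → ℝ} (hk : ∀ i, 0 < k i)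
    (hQ : 0 < descartes k) (hnn : ∀ w, 0 ≤ definiteForm k w) {z : Fin 4 → ℝ}
    (hz : definiteForm k z = 0) : z = 0 := by
  have hlin : ∀ w, angleForm k z w + (∑ i, k i * z i) * ∑ i, k i * w i = 0 := by
    intro w
    refine eq_zero_of_forall_quadratic_nonneg (c := definiteForm k w) fun ε => ?_
    have := hnn (z + ε • w)
    rw [definiteForm_add_smul hk, hz] at this
    linarith
  have hpos := sum_mul_self_pos hk
  have horth : ∑ i, k i * z i = 0 := by
    have := hlin k
    rw [angleForm_comm hk, angleForm_self_left, zero_add] at this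
    exact (mul_eq_zero.mp this).resolve_right hpos.ne'
  obtain ⟨c, rfl⟩ := eq_smul_of_angleForm_eq_zero hk hQ (z := z) fun w => by
    simpa [horth] using hlin w
  have : c * ∑ i, k i * k i = 0 := by
    rw [← horth, Finset.mul_sum]
    exact Finset.sum_congr rfl fun i _ => by simp only [Pi.smul_apply, smul_eq_mul]; ring
  rw [(mul_eq_zero.mp this).resolve_right hpos.ne', zero_smul]

lemma continuous_definiteForm {X : Type*} [TopologicalSpace X] {k z : X → Fin 4 → ℝ}
    (hk : Continuous k) (hz : Continuous z) (hpos : ∀ x i, 0 < k x i) :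
    Continuous fun x => definiteForm (k x) (z x) := by
  have h3 : Continuous fun x => descartes (k x) := by unfold descartes; fun_prop
  have h4 : ∀ j, Continuous fun x => faceSum (k x) j := by intro j; unfold faceSum; fun_prop
  have h5 : ∀ j, Continuous fun x => faceSum (z x) j := by intro j; unfold faceSum; fun_prop
  have h6 : Continuous fun x => descartesPolar (k x) (z x) := by unfold descartesPolar; fun_prop
  have h7 : ∀ j, Continuous fun x => faceAngleVariation (k x) (z x) j := by
    intro j
    unfold faceAngleVariation
    exact Continuous.div (by fun_prop) (by fun_prop)
      fun p => (descartes_add_faceSum_sq_pos (hpos p) j).ne'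
  have h8 : ∀ j, Continuous fun x => z x j / k x j ^ 2 :=
    fun j => Continuous.div (by fun_prop) (by fun_prop) fun p => (pow_pos (hpos p j) 2).ne'
  unfold definiteForm angleForm
  fun_prop

lemma definiteForm_nonneg_of_sphere {k : Fin 4 → ℝ} (hk : ∀ i, 0 < k i)
    (h : ∀ z ∈ Metric.sphere (0 : Fin 4 → ℝ) 1, 0 ≤ definiteForm k z) (z : Fin 4 → ℝ) :
    0 ≤ definiteForm k z := by
  rcases eq_or_ne z 0 with rfl | hz
  · rw [definiteForm_zero]
  · have hz' : 0 < ‖z‖ := norm_pos_iff.mpr hz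
    have := h (‖z‖⁻¹ • z) (by simp [norm_smul, hz'.ne'])
    rw [definiteForm_smul hk] at this
    exact nonneg_of_mul_nonneg_right this (by positivity)

lemma definiteForm_one_nonneg (z : Fin 4 → ℝ) : 0 ≤ definiteForm (fun _ => 1) z := by
  simp only [definiteForm, angleForm_one_self, Fin.sum_univ_four]
  nlinarith [sq_nonneg (z 0 - z 1), sq_nonneg (z 0 - z 2), sq_nonneg (z 0 - z 3),
    sq_nonneg (z 1 - z 2), sq_nonneg (z 1 - z 3), sq_nonneg (z 2 - z 3),
    sq_nonneg (z 0 + z 1 + z 2 + z 3)]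

/-- Deformation to the regular tetrahedron `(1, 1, 1, 1)`, where the form is explicit. The minimum
over the unit sphere depends continuously on the parameter and is never zero: if it were, the form
would be semidefinite there with a null vector of norm one. So it cannot change sign. -/
lemma definiteForm_nonneg {k : Fin 4 → ℝ} (hk : ∀ i, 0 < k i) (hQ : 0 < descartes k)
    (z : Fin 4 → ℝ) : 0 ≤ definiteForm k z := by
  set κ : unitInterval → Fin 4 → ℝ := fun t i => 1 + t * (k i - 1) with hκ
  have κpos : ∀ t i, 0 < κ t i := by
    intro t i
    have h0 := t.2.1
    have h1 := t.2.2
    have := hk i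
    rcases eq_or_lt_of_le h1 with h | h
    · simp [hκ, h, this]
    · simp only [hκ]
      nlinarith [mul_nonneg h0 this.le]
  have κQ : ∀ t, 0 < descartes (κ t) := fun t => descartes_segment_pos hk hQ t.2.1 t.2.2
  have hκ0 : κ 0 = fun _ => 1 := by funext i; simp [hκ]
  have hκ1 : κ 1 = k := by funext i; simp [hκ]
  have hκc : Continuous κ := by simp only [hκ]; fun_prop
  clear_value κ
  have hcont : Continuous ↿fun t => definiteForm (κ t) :=
    continuous_definiteForm (X := unitInterval × (Fin 4 → ℝ)) (hκc.comp continuous_fst)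
      continuous_snd fun p => κpos p.1
  set S : Set (Fin 4 → ℝ) := Metric.sphere 0 1 with hS
  have hSc : IsCompact S := isCompact_sphere _ _
  have hSne : S.Nonempty := NormedSpace.sphere_nonempty.mpr zero_le_one
  set m : unitInterval → ℝ := fun t => sInf (definiteForm (κ t) '' S)
  have hmcont : Continuous m := hSc.continuous_sInf hcont
  have hmin : ∀ t, ∃ z ∈ S, m t = definiteForm (κ t) z ∧
      ∀ w ∈ S, definiteForm (κ t) z ≤ definiteForm (κ t) w := fun t =>
    hSc.exists_sInf_image_eq_and_le hSne
      (hcont.comp (by fun_prop : Continuous fun z => (t, z))).continuousOn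
  have hnonneg : ∀ t, 0 ≤ m t → ∀ z, 0 ≤ definiteForm (κ t) z := by
    intro t ht
    obtain ⟨z₀, -, h1, h2⟩ := hmin t
    exact definiteForm_nonneg_of_sphere (κpos t) fun z hz => (h1 ▸ ht).trans (h2 z hz)
  have hm_ne : ∀ t, m t ≠ 0 := by
    intro t ht
    obtain ⟨z₀, hz₀, h1, -⟩ := hmin t
    have := eq_zero_of_definiteForm_eq_zero (κpos t) (κQ t) (hnonneg t ht.ge) (h1 ▸ ht)
    rw [this] at hz₀
    simp [hS] at hz₀
  have hm0 : 0 ≤ m 0 := by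
    obtain ⟨z₀, -, h1, -⟩ := hmin 0
    rw [h1, hκ0]
    exact definiteForm_one_nonneg z₀
  have hm1 : 0 ≤ m 1 := by
    by_contra! hlt
    obtain ⟨t, ht⟩ := mem_range_of_exists_le_of_exists_ge hmcont ⟨1, hlt.le⟩ ⟨0, hm0⟩
    exact hm_ne t ht
  exact hκ1 ▸ hnonneg 1 hm1 z

lemma angleForm_nonneg {k : Fin 4 → ℝ} (hk : ∀ i, 0 < k i) (hQ : 0 < descartes k)
    (z : Fin 4 → ℝ) : 0 ≤ angleForm k z z := by
  -- remove the component of `z` along `k`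
  have hpos := sum_mul_self_pos hk
  set c := -((∑ i, k i * z i) / ∑ i, k i * k i) with hc
  have h := definiteForm_nonneg hk hQ (z + c • k)
  have h1 : ∑ i, k i * z i + c * ∑ i, k i * k i = 0 := by
    rw [hc, neg_mul, div_mul_cancel₀ _ hpos.ne', add_neg_cancel]
  rw [definiteForm, sum_mul_add_smul, h1, angleForm_add_smul_left, angleForm_self_left,
    angleForm_add_smul_right hk, angleForm_comm hk z k, angleForm_self_left] at h
  simpa using h

lemma eq_smul_of_angleForm_self_eq_zero {k : Fin 4 → ℝ} (hk : ∀ i, 0 < k i)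
    (hQ : 0 < descartes k) {z : Fin 4 → ℝ} (h : angleForm k z z = 0) : ∃ c : ℝ, z = c • k := by
  refine eq_smul_of_angleForm_eq_zero hk hQ fun w => ?_
  refine eq_zero_of_forall_quadratic_nonneg (c := angleForm k w w) fun ε => ?_
  have := angleForm_nonneg hk hQ (z + ε • w)
  rw [angleForm_add_smul_left, angleForm_add_smul_right hk, angleForm_add_smul_right hk, h,
    angleForm_comm hk w z] at this
  linarith

end

/-! ### Extended solid angles and their monotonicity along segments -/

noncomputable section

open Set Filter Topology

/-- For the inverse radii `k` of the balls at the vertices of a tetrahedron, the angle under which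
the sphere tangent to all edges meets the face opposite to the vertex `j` (measured from the normal
position). -/
def faceAngle (k : Fin 4 → ℝ) (j : Fin 4) : ℝ :=
  Real.arcsin (faceSum k j / √(descartes k + faceSum k j ^ 2))

lemma faceAngle_eq_arctan {k : Fin 4 → ℝ} (hQ : 0 < descartes k) (j : Fin 4) :
    faceAngle k j = Real.arctan (faceSum k j / √(descartes k)) := by
  rw [Real.arctan_eq_arcsin, faceAngle]
  congr 1
  have hs : 0 < √(descartes k) := Real.sqrt_pos.mpr hQ
  rw [div_div, ← Real.sqrt_mul hQ.le, div_pow, Real.sq_sqrt hQ.le, mul_add, mul_one,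
    mul_div_cancel₀ _ hQ.ne']

/-- For `descartes k ≤ 0` the quotient has absolute value at least one, where `Real.arcsin` is
constant. This is why `faceAngle` is written with an arcsine: it is the continuous extension of the
arctangent formula. -/
lemma faceAngle_eq_or {k : Fin 4 → ℝ} (hk : ∀ i, 0 < k i) (hQ : descartes k ≤ 0) (j : Fin 4) :
    faceAngle k j = Real.pi / 2 ∨ faceAngle k j = -(Real.pi / 2) := by
  have hs := Real.sqrt_pos.mpr (descartes_add_faceSum_sq_pos hk j)
  have hle : √(descartes k + faceSum k j ^ 2) ≤ |faceSum k j| := by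
    rw [← Real.sqrt_sq_eq_abs]
    exact Real.sqrt_le_sqrt (by linarith)
  rcases le_total 0 (faceSum k j) with h | h
  · left
    rw [abs_of_nonneg h] at hle
    exact Real.arcsin_of_one_le ((one_le_div hs).mpr hle)
  · right
    rw [abs_of_nonpos h] at hle
    exact Real.arcsin_of_le_neg_one ((div_le_iff₀ hs).mpr (by linarith))

lemma continuous_descartes : Continuous descartes := by unfold descartes; fun_prop

lemma continuous_faceSum (j : Fin 4) : Continuous fun k => faceSum k j := by
  unfold faceSum; fun_prop

lemma continuousAt_faceAngle {k : Fin 4 → ℝ} (hk : ∀ i, 0 < k i) (j : Fin 4) :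
    ContinuousAt (fun k => faceAngle k j) k := by
  have h1 := continuous_descartes
  have h2 := continuous_faceSum j
  refine Real.continuous_arcsin.continuousAt.comp (ContinuousAt.div h2.continuousAt ?_ ?_)
  · fun_prop
  · exact (Real.sqrt_pos.mpr (descartes_add_faceSum_sq_pos hk j)).ne'

lemma faceAngle_eventuallyEq {k : Fin 4 → ℝ} (hQ : 0 < descartes k) (j : Fin 4) :
    (fun k => faceAngle k j) =ᶠ[𝓝 k] fun k => Real.arctan (faceSum k j / √(descartes k)) := by
  filter_upwards [continuous_descartes.continuousAt.eventually (lt_mem_nhds hQ)] with k' hk'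
  exact faceAngle_eq_arctan hk' j

lemma differentiableAt_faceAngle {k : Fin 4 → ℝ} (hQ : 0 < descartes k) (j : Fin 4) :
    DifferentiableAt ℝ (fun k => faceAngle k j) k := by
  refine DifferentiableAt.congr_of_eventuallyEq ?_ (faceAngle_eventuallyEq hQ j)
  have h1 : Differentiable ℝ descartes := by unfold descartes; fun_prop
  have h2 : Differentiable ℝ fun k => faceSum k j := by unfold faceSum; fun_prop
  have h3 : DifferentiableAt ℝ (fun k => √(descartes k)) k := (h1 k).sqrt hQ.ne'
  simp only [div_eq_mul_inv]
  exact ((h2 k).fun_mul (h3.fun_inv (Real.sqrt_pos.mpr hQ).ne')).arctan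

lemma hasDerivAt_faceAngle {k : ℝ → Fin 4 → ℝ} {z : Fin 4 → ℝ} {t : ℝ}
    (hk : ∀ i, 0 < k t i) (hQ : 0 < descartes (k t))
    (h : ∀ i, HasDerivAt (fun s => k s i) (z i) t) (j : Fin 4) :
    HasDerivAt (fun s => faceAngle (k s) j)
      (faceAngleVariation (k t) z j / √(descartes (k t))) t := by
  have hkc : ContinuousAt k t := continuousAt_pi.mpr fun i => (h i).continuousAt
  refine HasDerivAt.congr_of_eventuallyEq ?_ (hkc.eventually (faceAngle_eventuallyEq hQ j))
  have hP : HasDerivAt (fun s => faceSum (k s) j) (faceSum z j) t := by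
    unfold faceSum
    exact (HasDerivAt.fun_sum fun i _ => h i).sub ((h j).const_mul 2)
  have hD : HasDerivAt (fun s => descartes (k s)) (2 * descartesPolar (k t) z) t := by
    unfold descartes
    have := ((HasDerivAt.fun_sum fun i (_ : i ∈ Finset.univ) => h i).fun_pow 2).sub
      ((HasDerivAt.fun_sum fun i (_ : i ∈ Finset.univ) => (h i).fun_pow 2).const_mul 2)
    refine this.congr_deriv ?_
    simp only [descartesPolar, faceSum, Fin.sum_univ_four]
    push_cast
    ring
  have hs : 0 < √(descartes (k t)) := Real.sqrt_pos.mpr hQ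
  refine ((hP.fun_div (hD.sqrt hQ.ne') hs.ne').arctan).congr_deriv ?_
  have hE := descartes_add_faceSum_sq_pos hk j
  rw [faceAngleVariation]
  have hss : descartes (k t) = √(descartes (k t)) ^ 2 := (Real.sq_sqrt hQ.le).symm
  generalize √(descartes (k t)) = s at *
  rw [hss] at hE ⊢
  have : s ^ 2 + faceSum (k t) j ^ 2 ≠ 0 := hE.ne'
  field_simp

/-- The solid angle at the vertex `i` of a tetrahedron with the radii `r`. -/
def vertexAngle (r : Fin 4 → ℝ) (i : Fin 4) : ℝ :=
  2 * (∑ j, faceAngle r⁻¹ j - faceAngle r⁻¹ i) - Real.pi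

lemma sum_vertexAngle_mul (r v : Fin 4 → ℝ) :
    ∑ i, vertexAngle r i * v i =
      2 * ∑ j, faceAngle r⁻¹ j * (∑ i, v i - v j) - Real.pi * ∑ i, v i := by
  simp only [vertexAngle, Fin.sum_univ_four]; ring

/-- A continuous function that does not increase to the right of the points of `U` and takes only
finitely many values outside `U` is antitone. -/
lemma antitoneOn_of_finite_image {h : ℝ → ℝ} {a b : ℝ} (hc : ContinuousOn h (Icc a b))
    {U : Set ℝ} (hfin : (h '' (Icc a b \ U)).Finite)
    (hU : ∀ t ∈ Ico a b ∩ U, ∃ ε > 0, ∀ s ∈ Ioo t (t + ε), h s ≤ h t) :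
    AntitoneOn h (Icc a b) := by
  intro x hx y hy hxy
  by_contra! hlt
  -- An increase would run through infinitely many values, so some value `c` is taken only in `U`.
  obtain ⟨c, hc1, hc2⟩ : ∃ c ∈ Ioo (h x) (h y), c ∉ h '' (Icc a b \ U) := by
    by_contra! H
    exact (Ioo_infinite hlt) (hfin.subset H)
  set S := {t ∈ Icc x y | h t ≤ c} with hS
  have hcxy : ContinuousOn h (Icc x y) := hc.mono (Icc_subset_Icc hx.1 hy.2)
  have hSc : IsCompact S := by
    have : S = Icc x y ∩ h ⁻¹' Iic c := rfl
    rw [this]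
    exact isCompact_Icc.of_isClosed_subset
      (hcxy.preimage_isClosed_of_isClosed isClosed_Icc isClosed_Iic) inter_subset_left
  -- At the last point with `h t ≤ c` there is equality, so `t` lies in `U`; but `h` exceeds `c`
  -- immediately to its right.
  obtain ⟨t, ht⟩ := hSc.exists_isGreatest ⟨x, ⟨le_rfl, hxy⟩, hc1.1.le⟩
  have hty : t < y := lt_of_le_of_ne ht.1.1.2 fun e => by
    have := ht.1.2
    rw [e] at this
    linarith [hc1.2]
  have hgt : ∀ s ∈ Ioc t y, c < h s := by
    intro s hs
    by_contra! hle
    exact absurd (ht.2 ⟨⟨ht.1.1.1.trans hs.1.le, hs.2⟩, hle⟩) (not_le.mpr hs.1)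
  have htc : h t = c := by
    refine le_antisymm ht.1.2 ?_
    have h1 : Tendsto h (𝓝[Ioc t y] t) (𝓝 (h t)) :=
      (hcxy t ht.1.1).mono (Ioc_subset_Icc_self.trans (Icc_subset_Icc_left ht.1.1.1))
    have : (𝓝[Ioc t y] t).NeBot := by
      rw [nhdsWithin_Ioc_eq_nhdsGT hty]; infer_instance
    exact ge_of_tendsto h1 (eventually_nhdsWithin_of_forall fun s hs => (hgt s hs).le)
  have htab : t ∈ Icc a b := ⟨hx.1.trans ht.1.1.1, hty.le.trans hy.2⟩
  have htU : t ∈ U := by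
    by_contra hn
    exact hc2 ⟨t, ⟨htab, hn⟩, htc⟩
  obtain ⟨ε, hε, H⟩ := hU t ⟨⟨htab.1, hty.trans_le hy.2⟩, htU⟩
  set s := min y (t + ε / 2)
  have hs1 : t < s := lt_min hty (by linarith)
  have h1 := hgt s ⟨hs1, min_le_left _ _⟩
  have h2 := H s ⟨hs1, (min_le_right _ _).trans_lt (by linarith)⟩
  linarith

section Segment

variable {a b : Fin 4 → ℝ}

lemma segment_pos (ha : ∀ i, 0 < a i) (hb : ∀ i, 0 < b i) {t : ℝ} (ht : t ∈ Icc (0 : ℝ) 1)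
    (i : Fin 4) : 0 < (a + t • (b - a)) i := by
  have h1 := ha i
  have h2 := hb i
  simp only [Pi.add_apply, Pi.smul_apply, Pi.sub_apply, smul_eq_mul]
  rcases eq_or_lt_of_le ht.2 with h | h
  · rw [h]; linarith
  · nlinarith [mul_nonneg ht.1 h2.le, mul_pos (sub_pos.mpr h) h1]

lemma hasDerivAt_inv_line {r v : Fin 4 → ℝ} {t : ℝ} (hr : ∀ i, 0 < (r + t • v) i) (i : Fin 4) :
    HasDerivAt (fun s : ℝ => (r + s • v)⁻¹ i) (-(v i) * ((r + t • v)⁻¹ i) ^ 2) t := by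
  have h : HasDerivAt (fun s : ℝ => (r + s • v) i) (v i) t := by
    simpa using ((hasDerivAt_id t).smul_const (v i)).const_add (r i)
  refine (h.inv (hr i).ne').congr_deriv ?_
  simp [div_eq_mul_inv]

/-- The radii move with velocity `v`, so the inverse radii move with velocity `-v * k ^ 2`. The
weight `w` gets the same factor because `angleForm` divides its second argument by `k ^ 2`; in this
form the derivative is symmetric in `v` and `w`. -/
lemma hasDerivAt_sum_vertexAngle_mul {r v : Fin 4 → ℝ} (w : Fin 4 → ℝ) {t : ℝ}
    (hr : ∀ i, 0 < (r + t • v) i) (hQ : 0 < descartes (r + t • v)⁻¹) :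
    HasDerivAt (fun s : ℝ => ∑ i, vertexAngle (r + s • v) i * w i)
      (-(2 / √(descartes (r + t • v)⁻¹) * angleForm (r + t • v)⁻¹
        (fun i => -(v i) * ((r + t • v)⁻¹ i) ^ 2) (fun i => -(w i) * ((r + t • v)⁻¹ i) ^ 2))) t := by
  simp only [sum_vertexAngle_mul]
  have hk : ∀ i, 0 < (r + t • v)⁻¹ i := fun i => inv_pos.mpr (hr i)
  have := ((HasDerivAt.fun_sum fun j (_ : j ∈ Finset.univ) =>
    (hasDerivAt_faceAngle (k := fun s : ℝ => (r + s • v)⁻¹) hk hQ (hasDerivAt_inv_line hr)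
      j).mul_const (∑ i, w i - w j)).const_mul 2).sub_const (Real.pi * ∑ i, w i)
  refine this.congr_deriv ?_
  have hd : ∀ i, -(w i) * ((r + t • v)⁻¹ i) ^ 2 / (r + t • v)⁻¹ i ^ 2 = -(w i) := fun i =>
    mul_div_cancel_right₀ _ (pow_pos (hk i) 2).ne'
  simp only [angleForm, hd, Finset.mul_sum, ← Finset.sum_neg_distrib]
  refine Finset.sum_congr rfl fun j _ => ?_
  simp only [Finset.sum_neg_distrib]
  ring

lemma antitoneOn_sum_vertexAngle_mul (ha : ∀ i, 0 < a i) (hb : ∀ i, 0 < b i) :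
    AntitoneOn (fun t : ℝ => ∑ i, vertexAngle (a + t • (b - a)) i * (b - a) i) (Icc 0 1) := by
  set v := b - a
  have hline : Continuous fun t : ℝ => a + t • v := by fun_prop
  have hinv : ContinuousOn (fun t : ℝ => (a + t • v)⁻¹) (Icc 0 1) := fun t ht => by
    refine ContinuousAt.continuousWithinAt (continuousAt_pi.mpr fun i => ?_)
    exact (hasDerivAt_inv_line (segment_pos ha hb ht) i).continuousAt
  have hface : ∀ j, ContinuousOn (fun t : ℝ => faceAngle (a + t • v)⁻¹ j) (Icc 0 1) :=
    fun j t ht => ContinuousAt.comp_continuousWithinAt (g := fun k => faceAngle k j)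
      (f := fun t : ℝ => (a + t • v)⁻¹)
      (continuousAt_faceAngle (fun i => inv_pos.mpr (segment_pos ha hb ht i)) j) (hinv t ht)
  refine antitoneOn_of_finite_image (U := {t | 0 < descartes (a + t • v)⁻¹}) ?_ ?_ ?_
  · unfold vertexAngle
    fun_prop
  · set F : Finset ℝ := {Real.pi / 2, -(Real.pi / 2)}
    -- The sum depends on `t` only through the four face angles, each of which has two possible
    -- values where the Descartes form is not positive.
    set G : (Fin 4 → ℝ) → ℝ := fun θ => 2 * ∑ j, θ j * (∑ i, v i - v j) - Real.pi * ∑ i, v i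
    refine ((Fintype.piFinset fun _ : Fin 4 => F).finite_toSet.image G).subset ?_
    rintro _ ⟨t, ⟨ht, hQ⟩, rfl⟩
    refine ⟨faceAngle (a + t • v)⁻¹, ?_, (sum_vertexAngle_mul _ _).symm⟩
    rw [Finset.mem_coe, Fintype.mem_piFinset]
    intro j
    rw [Finset.mem_insert, Finset.mem_singleton]
    exact faceAngle_eq_or (fun i => inv_pos.mpr (segment_pos ha hb ht i)) (not_lt.mp hQ) j
  · rintro t ⟨ht, hQ⟩
    have ht' : t ∈ Icc (0 : ℝ) 1 := Ico_subset_Icc_self ht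
    have hev : ∀ᶠ s in 𝓝 t, (∀ i, 0 < (a + s • v) i) ∧ 0 < descartes (a + s • v)⁻¹ := by
      refine (eventually_all.mpr fun i => ?_).and ?_
      · exact ((continuous_apply i).comp hline).continuousAt.eventually
          (lt_mem_nhds (segment_pos ha hb ht' i))
      · have : ContinuousAt (fun s : ℝ => (a + s • v)⁻¹) t := continuousAt_pi.mpr fun i =>
          (hasDerivAt_inv_line (segment_pos ha hb ht') i).continuousAt
        exact (continuous_descartes.continuousAt.comp this).eventually (lt_mem_nhds hQ)
    obtain ⟨ε, hε, H⟩ := Metric.eventually_nhds_iff_ball.mp hev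
    refine ⟨ε, hε, fun s hs => ?_⟩
    have hsub : ∀ x ∈ Icc t s, x ∈ Metric.ball t ε := by
      intro x hx
      rw [Metric.mem_ball, Real.dist_eq, abs_lt]
      constructor <;> linarith [hx.1, hx.2, hs.2]
    have hder : ∀ x ∈ Icc t s, HasDerivAt _ _ x := fun x hx =>
      hasDerivAt_sum_vertexAngle_mul v (H x (hsub x hx)).1 (H x (hsub x hx)).2
    refine antitoneOn_of_hasDerivWithinAt_nonpos (convex_Icc t s)
      (fun x hx => (hder x hx).continuousAt.continuousWithinAt)
      (fun x hx => (hder x (interior_subset hx)).hasDerivWithinAt) (fun x hx => ?_)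
      (left_mem_Icc.mpr hs.1.le) (right_mem_Icc.mpr hs.1.le) hs.1.le
    obtain ⟨h1, h2⟩ := H x (hsub x (interior_subset hx))
    exact neg_nonpos.mpr (mul_nonneg (by positivity)
      (angleForm_nonneg (fun i => inv_pos.mpr (h1 i)) h2 _))

theorem sum_vertexAngle_sub_mul_nonpos (ha : ∀ i, 0 < a i) (hb : ∀ i, 0 < b i) :
    ∑ i, (vertexAngle b i - vertexAngle a i) * (b i - a i) ≤ 0 := by
  have := antitoneOn_sum_vertexAngle_mul ha hb (left_mem_Icc.mpr zero_le_one)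
    (right_mem_Icc.mpr zero_le_one) zero_le_one
  simp only [zero_smul, add_zero, one_smul, add_sub_cancel] at this
  simp only [sub_mul, Finset.sum_sub_distrib]
  simpa using this

/-- An antitone function with equal end values is constant, so its derivative at `a` vanishes. This
puts the velocity of the inverse radii into the kernel spanned by `a⁻¹`, which says that `b - a` is
a multiple of `a`. -/
theorem eq_smul_of_sum_vertexAngle_sub_mul_eq_zero (ha : ∀ i, 0 < a i) (hb : ∀ i, 0 < b i)
    (hQ : 0 < descartes a⁻¹) (h : ∑ i, (vertexAngle b i - vertexAngle a i) * (b i - a i) = 0) :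
    ∃ c : ℝ, b = c • a := by
  have hanti := antitoneOn_sum_vertexAngle_mul ha hb
  set v := b - a with hv
  set f : ℝ → ℝ := fun t => ∑ i, vertexAngle (a + t • v) i * v i with hf
  have h01 : f 1 = f 0 := by
    have : a + (1 : ℝ) • v = b := by simp [hv]
    simp only [hf, this, zero_smul, add_zero]
    rw [← sub_eq_zero, ← Finset.sum_sub_distrib, ← h]
    exact Finset.sum_congr rfl fun i _ => by simp only [hv, Pi.sub_apply]; ring
  have hconst : ∀ t ∈ Icc (0 : ℝ) 1, f t = f 0 := fun t ht =>
    le_antisymm (hanti (left_mem_Icc.mpr zero_le_one) ht ht.1)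
      (h01 ▸ hanti ht (right_mem_Icc.mpr zero_le_one) ht.2)
  have ha0 : a + (0 : ℝ) • v = a := by simp
  have hder := hasDerivAt_sum_vertexAngle_mul (r := a) (v := v) v (t := 0) (by simpa [ha0] using ha)
    (by simpa only [ha0] using hQ)
  rw [ha0] at hder
  have hzero : HasDerivWithinAt f 0 (Icc 0 1) 0 :=
    (hasDerivWithinAt_const (0 : ℝ) (Icc 0 1) (f 0)).congr hconst rfl
  have heq := (uniqueDiffOn_Icc zero_lt_one 0 (left_mem_Icc.mpr zero_le_one)).eq_deriv _
    hder.hasDerivWithinAt hzero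
  have hs : 0 < √(descartes a⁻¹) := Real.sqrt_pos.mpr hQ
  have hk : ∀ i, 0 < a⁻¹ i := fun i => inv_pos.mpr (ha i)
  have hform := (mul_eq_zero.mp (neg_eq_zero.mp heq)).resolve_left (by positivity)
  obtain ⟨c, hc⟩ := eq_smul_of_angleForm_self_eq_zero hk hQ hform
  refine ⟨1 - c, funext fun i => ?_⟩
  have hi := congrFun hc i
  have hai := (ha i).ne'
  simp only [hv, Pi.smul_apply, Pi.inv_apply, Pi.sub_apply, smul_eq_mul] at hi ⊢
  field_simp at hi
  linarith

/-- The Schläfli formula. -/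
theorem hasDerivAt_sum_vertexAngle_mul_radius {r : Fin 4 → ℝ} (hr : ∀ i, 0 < r i)
    (hQ : 0 < descartes r⁻¹) (v : Fin 4 → ℝ) :
    HasDerivAt (fun s : ℝ => ∑ i, vertexAngle (r + s • v) i * r i) 0 0 := by
  have h0 : r + (0 : ℝ) • v = r := by simp
  have := hasDerivAt_sum_vertexAngle_mul (r := r) (v := v) r (t := 0) (by simpa [h0] using hr)
    (by simpa only [h0] using hQ)
  rw [h0] at this
  refine this.congr_deriv ?_
  have hk : ∀ i, 0 < r⁻¹ i := fun i => inv_pos.mpr (hr i)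
  -- For the weight `r` the second argument of the form becomes `-r⁻¹`, a kernel vector.
  have e : (fun i => -(r i) * (r⁻¹ i) ^ 2) = 0 + (-1 : ℝ) • r⁻¹ := by
    funext i
    have := (hr i).ne'
    simp only [zero_add, Pi.inv_apply, Pi.smul_apply, smul_eq_mul]
    field_simp
  rw [e, angleForm_comm hk, angleForm_add_smul_left, angleForm_self_left, angleForm_zero_left]
  simp

end Segment

lemma differentiableAt_vertexAngle {r : Fin 4 → ℝ} (hr : ∀ i, 0 < r i)
    (hQ : 0 < descartes r⁻¹) (i : Fin 4) : DifferentiableAt ℝ (fun r => vertexAngle r i) r := by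
  have hinv : DifferentiableAt ℝ (fun r : Fin 4 → ℝ => r⁻¹) r :=
    differentiableAt_pi.mpr fun i => (differentiableAt_apply i r).inv (hr i).ne'
  have h : ∀ j, DifferentiableAt ℝ (fun r : Fin 4 → ℝ => faceAngle r⁻¹ j) r := fun j =>
    DifferentiableAt.comp (g := fun k => faceAngle k j) r (differentiableAt_faceAngle hQ j) hinv
  unfold vertexAngle
  fun_prop

lemma descartes_smul (c : ℝ) (k : Fin 4 → ℝ) : descartes (c • k) = c ^ 2 * descartes k := by
  simp only [descartes, Fin.sum_univ_four, Pi.smul_apply, smul_eq_mul]; ring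

lemma faceAngle_smul {c : ℝ} (hc : 0 < c) (k : Fin 4 → ℝ) (j : Fin 4) :
    faceAngle (c • k) j = faceAngle k j := by
  have h : faceSum (c • k) j = c * faceSum k j := by
    simp only [faceSum, Fin.sum_univ_four, Pi.smul_apply, smul_eq_mul]; ring
  rw [faceAngle, descartes_smul, h, mul_pow, ← mul_add, Real.sqrt_mul (sq_nonneg c),
    Real.sqrt_sq hc.le, mul_div_mul_left _ _ hc.ne', faceAngle]

lemma vertexAngle_smul {c : ℝ} (hc : 0 < c) (r : Fin 4 → ℝ) (i : Fin 4) :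
    vertexAngle (c • r) i = vertexAngle r i := by
  have : (c • r)⁻¹ = c⁻¹ • r⁻¹ := by
    funext i; simp [mul_comm]
  simp only [vertexAngle, this, faceAngle_smul (inv_pos.mpr hc)]

lemma vertexAngle_comp_perm (r : Fin 4 → ℝ) (σ : Equiv.Perm (Fin 4)) (i : Fin 4) :
    vertexAngle (r ∘ σ) i = vertexAngle r (σ i) := by
  have h1 : ∀ f : Fin 4 → ℝ, ∑ i, f (σ i) = ∑ i, f i := fun f => Equiv.sum_comp σ f
  have h : ∀ j, faceAngle (r ∘ σ)⁻¹ j = faceAngle r⁻¹ (σ j) := fun j => by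
    simp only [faceAngle, faceSum, descartes, Pi.inv_apply, Function.comp_apply,
      h1 fun i => (r i)⁻¹, h1 fun i => (r i)⁻¹ ^ 2]
  simp only [vertexAngle, h, h1 (faceAngle r⁻¹)]

end

/-! ### Volumes of wedges of the unit ball -/

noncomputable section

open Set Filter Topology
open MeasureTheory Metric
open scoped InnerProductSpace ENNReal Pointwise

/-- The projection of Euclidean space to the plane of the first two coordinates. -/
def planeProj (x : E3) : ℂ := ⟨x 0, x 1⟩

lemma volume_cylinder_inter_ball {A : Set ℂ} (hA : MeasurableSet A) :
    (volume : Measure E3) {x | ‖x‖ < 1 ∧ planeProj x ∈ A} =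
      ∫⁻ w, A.indicator (fun w => volume {y : ℝ | y ^ 2 + ‖w‖ ^ 2 < 1}) w := by
  have e1 := EuclideanSpace.volume_preserving_symm_measurableEquiv_toLp (Fin 3)
  -- The last coordinate is split off as the axis; the first two form the complex plane.
  have e2 := volume_preserving_piFinSuccAbove (fun _ : Fin 3 => ℝ) 2
  have e3 := (MeasurePreserving.id (volume : Measure ℝ)).prod
    (Complex.volume_preserving_equiv_pi.symm Complex.measurableEquivPi)
  have e := e3.comp (e2.comp e1)
  set S : Set (ℝ × ℂ) := {p | p.1 ^ 2 + ‖p.2‖ ^ 2 < 1 ∧ p.2 ∈ A} with hS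
  have hSm : MeasurableSet S := by
    refine MeasurableSet.inter (measurableSet_lt (f := fun p : ℝ × ℂ => p.1 ^ 2 + ‖p.2‖ ^ 2)
      (by fun_prop) measurable_const) ?_
    exact measurable_snd hA
  have h1 := e.measure_preimage hSm.nullMeasurableSet
  have h2 : Measure.prod (volume : Measure ℝ) (volume : Measure ℂ) S =
      ∫⁻ w, A.indicator (fun w => volume {y : ℝ | y ^ 2 + ‖w‖ ^ 2 < 1}) w := by
    rw [Measure.prod_apply_symm hSm]
    refine lintegral_congr fun w => ?_
    by_cases hw : w ∈ A
    · simp [hS, hw, preimage]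
    · simp [hS, hw, preimage]
  rw [← h2, ← h1]
  congr 1
  ext x
  have hx : planeProj x = (x 0 : ℂ) + (x 1 : ℂ) * Complex.I := (Complex.mk_eq_add_mul_I _ _)
  have hm : ((Prod.map id ⇑Complex.measurableEquivPi.symm ∘
      ⇑(MeasurableEquiv.piFinSuccAbove (fun _ : Fin 3 => ℝ) 2) ∘
      ⇑(MeasurableEquiv.toLp 2 (Fin 3 → ℝ)).symm) x) = (x 2, planeProj x) := by
    rw [hx]; rfl
  rw [mem_preimage, hm]
  simp only [hS, mem_ofPred_eq]
  have hn : ‖x‖ < 1 ↔ x 2 ^ 2 + ‖planeProj x‖ ^ 2 < 1 := by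
    rw [← sq_lt_one_iff₀ (norm_nonneg x), EuclideanSpace.real_norm_sq_eq, Fin.sum_univ_three,
      Complex.sq_norm, Complex.normSq_apply]
    change _ ↔ x 2 ^ 2 + (x 0 * x 0 + x 1 * x 1) < 1
    constructor <;> intro h <;> linarith
  rw [hn]

/-- The volume of a sector of the unit ball around an axis is proportional to the angle. -/
lemma exists_volume_sector : ∃ C : ℝ≥0∞, ∀ (A : Set ℂ) (s : Set ℝ), MeasurableSet A →
    MeasurableSet s → s ⊆ Ioo (-Real.pi) Real.pi →
    (∀ ρ > 0, ∀ θ ∈ Ioo (-Real.pi) Real.pi, Complex.polarCoord.symm (ρ, θ) ∈ A ↔ θ ∈ s) →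
    (volume : Measure E3) {x | ‖x‖ < 1 ∧ planeProj x ∈ A} = C * volume s := by
  -- The radial factor of the integral in polar coordinates: `ρ` times the length of the chord of
  -- the ball above distance `ρ`.
  refine ⟨∫⁻ ρ in Ioi (0 : ℝ), ENNReal.ofReal ρ * volume {y : ℝ | y ^ 2 + |ρ| ^ 2 < 1}, ?_⟩
  intro A s hA hs hsub h
  rw [volume_cylinder_inter_ball hA, ← Complex.lintegral_comp_polarCoord_symm]
  have hmeas : Measurable fun ρ : ℝ => volume {y : ℝ | y ^ 2 + |ρ| ^ 2 < 1} := by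
    have : MeasurableSet {p : ℝ × ℝ | p.2 ^ 2 + |p.1| ^ 2 < 1} := by
      refine measurableSet_lt (f := fun p : ℝ × ℝ => p.2 ^ 2 + |p.1| ^ 2) ?_ measurable_const
      simp only [sq_abs]
      fun_prop
    exact measurable_measure_prodMk_left this
  have e : ∫⁻ p in polarCoord.target, ENNReal.ofReal p.1 •
      A.indicator (fun w => volume {y : ℝ | y ^ 2 + ‖w‖ ^ 2 < 1}) (Complex.polarCoord.symm p) =
      ∫⁻ p in polarCoord.target, (ENNReal.ofReal p.1 * volume {y : ℝ | y ^ 2 + |p.1| ^ 2 < 1}) *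
        s.indicator 1 p.2 := by
    refine setLIntegral_congr_fun polarCoord.open_target.measurableSet fun p hp => ?_
    rw [polarCoord_target] at hp
    have hA' := h p.1 hp.1 p.2 hp.2
    by_cases hps : p.2 ∈ s
    · have := hA'.mpr hps
      simp only [Prod.mk.eta] at this
      simp only [indicator_of_mem this, indicator_of_mem hps, Complex.norm_polarCoord_symm]
      simp
    · have : Complex.polarCoord.symm p ∉ A := fun hh => hps (hA'.mp hh)
      simp only [indicator_of_notMem this, indicator_of_notMem hps]
      simp
  rw [e, polarCoord_target, Measure.volume_eq_prod, ← Measure.prod_restrict,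
    lintegral_prod_mul (f := fun ρ : ℝ => ENNReal.ofReal ρ * volume {y : ℝ | y ^ 2 + |ρ| ^ 2 < 1})
      (g := s.indicator 1) ((by fun_prop : AEMeasurable _ _).mul hmeas.aemeasurable)
      ((measurable_one.indicator hs).aemeasurable)]
  congr 1
  rw [lintegral_indicator_one hs, Measure.restrict_apply hs, inter_eq_left.mpr hsub]

lemma volume_real_ball_E3 : (volume : Measure E3).real (ball 0 1) = 4 * Real.pi / 3 := by
  rw [measureReal_def, EuclideanSpace.volume_ball_fin_three]
  simp [ENNReal.toReal_ofReal (by positivity : (0 : ℝ) ≤ Real.pi * 4 / 3)]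
  ring

/-- The whole ball calibrates the constant of `exists_volume_sector`. In polar coordinates the two
half planes are centred at the directions `0` and `γ`, and they overlap in an interval of length `π
- γ`. -/
lemma volume_wedge_coord {γ : ℝ} (h0 : 0 < γ) (h1 : γ < Real.pi) :
    (volume : Measure E3).real {x | ‖x‖ < 1 ∧ 0 < x 0 ∧ 0 < Real.cos γ * x 0 + Real.sin γ * x 1} =
      2 / 3 * (Real.pi - γ) := by
  obtain ⟨C, hC⟩ := exists_volume_sector
  have hpi := Real.pi_pos
  have huniv := hC univ (Ioo (-Real.pi) Real.pi) .univ measurableSet_Ioo subset_rfl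
    (fun ρ _ θ hθ => by simp [hθ.1, hθ.2])
  have hball : {x : E3 | ‖x‖ < 1 ∧ planeProj x ∈ univ} = ball 0 1 := by
    ext x; simp
  rw [hball] at huniv
  have hC' : C.toReal = 2 / 3 := by
    have := congrArg ENNReal.toReal huniv
    rw [← measureReal_def, volume_real_ball_E3, ENNReal.toReal_mul, Real.volume_Ioo,
      ENNReal.toReal_ofReal (by linarith)] at this
    field_simp at this
    linarith
  have h := hC {w | 0 < w.re ∧ 0 < Real.cos γ * w.re + Real.sin γ * w.im}
    (Ioo (γ - Real.pi / 2) (Real.pi / 2)) ?_ measurableSet_Ioo ?_ ?_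
  · have hset : {x : E3 | ‖x‖ < 1 ∧ 0 < x 0 ∧ 0 < Real.cos γ * x 0 + Real.sin γ * x 1} =
      {x : E3 | ‖x‖ < 1 ∧ planeProj x ∈
        {w : ℂ | 0 < w.re ∧ 0 < Real.cos γ * w.re + Real.sin γ * w.im}} := rfl
    rw [measureReal_def, hset, h, ENNReal.toReal_mul, hC', Real.volume_Ioo,
      ENNReal.toReal_ofReal (by linarith)]
    ring
  · exact ((measurableSet_lt measurable_const Complex.measurable_re).inter
      (measurableSet_lt measurable_const
        (by fun_prop : Measurable fun w : ℂ => Real.cos γ * w.re + Real.sin γ * w.im)))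
  · exact Ioo_subset_Ioo (by linarith) (by linarith)
  · intro ρ hρ θ hθ
    have hre : (Complex.polarCoord.symm (ρ, θ)).re = ρ * Real.cos θ := by
      simp [Complex.cos_ofReal_re, Complex.sin_ofReal_im]
    have him : (Complex.polarCoord.symm (ρ, θ)).im = ρ * Real.sin θ := by
      simp [Complex.cos_ofReal_im, Complex.sin_ofReal_re]
    simp only [mem_ofPred_eq, hre, him]
    have hc : Real.cos γ * (ρ * Real.cos θ) + Real.sin γ * (ρ * Real.sin θ) =
      ρ * Real.cos (θ - γ) := by rw [Real.cos_sub]; ring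
    rw [hc, mul_pos_iff_of_pos_left hρ, mul_pos_iff_of_pos_left hρ]
    constructor
    · rintro ⟨hc1, hc2⟩
      have hθ2 : θ < Real.pi / 2 := by
        by_contra! hle
        exact absurd hc1 (not_lt.mpr (Real.cos_nonpos_of_pi_div_two_le_of_le hle
          (by linarith [hθ.2])))
      refine ⟨?_, hθ2⟩
      by_contra! hle
      have : Real.cos (γ - θ) ≤ 0 := Real.cos_nonpos_of_pi_div_two_le_of_le (by linarith) (by
        by_contra! hgt
        exact absurd hc1 (not_lt.mpr (by
          rw [← Real.cos_neg]
          exact Real.cos_nonpos_of_pi_div_two_le_of_le (by linarith) (by linarith [hθ.1]))))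
      rw [← Real.cos_neg, neg_sub] at this
      linarith
    · rintro ⟨ha, hb⟩
      exact ⟨Real.cos_pos_of_mem_Ioo ⟨by linarith, hb⟩,
        Real.cos_pos_of_mem_Ioo ⟨by linarith, by linarith⟩⟩

open InnerProductGeometry in
/-- The volume of a wedge of the unit ball. -/
lemma volume_wedge {m n : E3} (h : LinearIndependent ℝ ![m, n]) :
    (volume : Measure E3).real {x | ‖x‖ < 1 ∧ 0 < ⟪m, x⟫_ℝ ∧ 0 < ⟪n, x⟫_ℝ} =
      2 / 3 * (Real.pi - angle m n) := by
  have hm : m ≠ 0 := h.ne_zero 0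
  have hn : n ≠ 0 := h.ne_zero 1
  have hm' : 0 < ‖m‖ := norm_pos_iff.mpr hm
  have hn' : 0 < ‖n‖ := norm_pos_iff.mpr hn
  have hpair := LinearIndependent.pair_iff.mp h
  set γ := angle m n with hγ
  have h0 : 0 < γ := by
    refine lt_of_le_of_ne (angle_nonneg m n) fun h' => ?_
    obtain ⟨-, r, -, hr⟩ := angle_eq_zero_iff.mp h'.symm
    have := hpair r (-1) (by rw [hr]; simp)
    simpa using this.2
  have h1 : γ < Real.pi := by
    refine lt_of_le_of_ne (angle_le_pi m n) fun h' => ?_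
    obtain ⟨-, r, -, hr⟩ := angle_eq_pi_iff.mp h'
    have := hpair r (-1) (by rw [hr]; simp)
    simpa using this.2
  have hs : 0 < Real.sin γ := Real.sin_pos_of_pos_of_lt_pi h0 h1
  have hinner : ⟪m, n⟫_ℝ = ‖m‖ * ‖n‖ * Real.cos γ := by
    rw [hγ, mul_comm, cos_angle_mul_norm_mul_norm]
  -- Gram–Schmidt on the two normals; the coordinates of the resulting orthonormal basis reduce the
  -- wedge to `volume_wedge_coord`.
  obtain ⟨b₀, hb₀⟩ : ∃ b₀ : E3, b₀ = ‖m‖⁻¹ • m := ⟨_, rfl⟩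
  obtain ⟨u, hu⟩ : ∃ u : E3, u = ‖n‖⁻¹ • n := ⟨_, rfl⟩
  obtain ⟨b₁, hb₁⟩ : ∃ b₁ : E3, b₁ = (Real.sin γ)⁻¹ • (u - Real.cos γ • b₀) := ⟨_, rfl⟩
  have i00 : ⟪b₀, b₀⟫_ℝ = 1 := by
    rw [hb₀, real_inner_smul_left, real_inner_smul_right, real_inner_self_eq_norm_sq]
    field_simp
  have i0u : ⟪b₀, u⟫_ℝ = Real.cos γ := by
    rw [hb₀, hu, real_inner_smul_left, real_inner_smul_right, hinner]
    field_simp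
  have iu0 : ⟪u, b₀⟫_ℝ = Real.cos γ := by rw [real_inner_comm, i0u]
  have iuu : ⟪u, u⟫_ℝ = 1 := by
    rw [hu, real_inner_smul_left, real_inner_smul_right, real_inner_self_eq_norm_sq]
    field_simp
  have i01 : ⟪b₀, b₁⟫_ℝ = 0 := by
    rw [hb₁, real_inner_smul_right, inner_sub_right, i0u, real_inner_smul_right, i00]
    simp
  have i10 : ⟪b₁, b₀⟫_ℝ = 0 := by rw [real_inner_comm, i01]
  have i11 : ⟪b₁, b₁⟫_ℝ = 1 := by
    simp only [hb₁, real_inner_smul_right, real_inner_smul_left, inner_sub_right, inner_sub_left,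
      i0u, iu0, iuu, i00]
    have := Real.sin_sq_add_cos_sq γ
    field_simp
    linarith
  obtain ⟨b, hb⟩ := Orthonormal.exists_orthonormalBasis_extension_of_card_eq (𝕜 := ℝ) (E := E3)
    (ι := Fin 3) (by simp) (v := ![b₀, b₁, 0]) (s := {0, 1}) (by
      rw [orthonormal_iff_ite]
      rintro ⟨i, hi⟩ ⟨j, hj⟩
      simp only [Subtype.mk.injEq, domRestrict_apply]
      rcases hi with rfl | rfl <;> rcases hj with rfl | rfl <;>
        simp [-inner_self_eq_norm_sq_to_K, i00, i01, i11, i10])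
  have hbz : b 0 = b₀ := hb 0 (by simp)
  have hbo : b 1 = b₁ := hb 1 (by simp)
  have hset : {x : E3 | ‖x‖ < 1 ∧ 0 < ⟪m, x⟫_ℝ ∧ 0 < ⟪n, x⟫_ℝ} = b.repr ⁻¹'
      {x | ‖x‖ < 1 ∧ 0 < x 0 ∧ 0 < Real.cos γ * x 0 + Real.sin γ * x 1} := by
    ext x
    have em : ⟪m, x⟫_ℝ = ‖m‖ * ⟪b₀, x⟫_ℝ := by
      rw [hb₀, real_inner_smul_left]; field_simp
    have en : ⟪n, x⟫_ℝ = ‖n‖ * (Real.cos γ * ⟪b₀, x⟫_ℝ + Real.sin γ * ⟪b₁, x⟫_ℝ) := by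
      rw [hb₁, real_inner_smul_left, inner_sub_left, real_inner_smul_left, hu,
        real_inner_smul_left]
      field_simp
      ring
    simp only [mem_ofPred_eq, mem_preimage, b.repr_apply_apply, hbz, hbo, em, en,
      LinearIsometryEquiv.norm_map, mul_pos_iff_of_pos_left hm', mul_pos_iff_of_pos_left hn']
  have hmeas : MeasurableSet
      {x : E3 | ‖x‖ < 1 ∧ 0 < x 0 ∧ 0 < Real.cos γ * x 0 + Real.sin γ * x 1} := by
    have h0 : Measurable fun x : E3 => x 0 := by fun_prop
    have h1 : Measurable fun x : E3 => x 1 := by fun_prop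
    exact (measurableSet_lt measurable_norm measurable_const).inter
      ((measurableSet_lt measurable_const h0).inter
      (measurableSet_lt measurable_const ((h0.const_mul _).add (h1.const_mul _))))
  rw [hset, measureReal_def, b.measurePreserving_repr.measure_preimage hmeas.nullMeasurableSet,
    ← measureReal_def, volume_wedge_coord h0 h1]

end

/-! ### Girard's theorem -/

noncomputable section

open Set Filter Topology
open MeasureTheory Metric
open scoped InnerProductSpace ENNReal Pointwise

lemma volume_orthogonal_hyperplane {n : E3} (hn : n ≠ 0) :
    (volume : Measure E3) {x | ⟪n, x⟫_ℝ = 0} = 0 := by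
  have h := Measure.addHaar_submodule (volume : Measure E3) (LinearMap.ker (innerₛₗ ℝ n)) (by
    intro htop
    have : n ∈ LinearMap.ker (innerₛₗ ℝ n) := htop ▸ Submodule.mem_top
    simp [LinearMap.mem_ker] at this
    exact hn this)
  exact h

lemma measurableSet_openHalfSpace (n : E3) : MeasurableSet {x : E3 | 0 < ⟪n, x⟫_ℝ} :=
  measurableSet_lt measurable_const (by fun_prop : Measurable fun x : E3 => ⟪n, x⟫_ℝ)

lemma measurableSet_closedHalfSpace (n : E3) : MeasurableSet {x : E3 | 0 ≤ ⟪n, x⟫_ℝ} :=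
  measurableSet_le measurable_const (by fun_prop : Measurable fun x : E3 => ⟪n, x⟫_ℝ)

/-- The volume measure of the open unit ball. -/
def ballMeasure : Measure E3 := volume.restrict (ball 0 1)

instance : IsFiniteMeasure ballMeasure := by
  unfold ballMeasure
  exact ⟨by simp⟩

lemma ballMeasure_ae_ne {n : E3} (hn : n ≠ 0) : ∀ᵐ x ∂ballMeasure, ⟪n, x⟫_ℝ ≠ 0 := by
  refine ae_restrict_of_ae ?_
  rw [ae_iff]
  simpa using volume_orthogonal_hyperplane hn

lemma ballMeasure_real_neg {s : Set E3} (hs : MeasurableSet s) :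
    ballMeasure.real (-s) = ballMeasure.real s := by
  have hb : -s ∩ ball (0 : E3) 1 = -(s ∩ ball 0 1) := by
    rw [Set.inter_neg]
    congr 1
    ext x
    simp
  simp only [measureReal_def, ballMeasure, Measure.restrict_apply hs,
    Measure.restrict_apply hs.neg, hb, Measure.measure_neg]

lemma ballMeasure_real_univ : ballMeasure.real univ = 4 * Real.pi / 3 := by
  rw [measureReal_def, ballMeasure, Measure.restrict_apply_univ, ← measureReal_def,
    volume_real_ball_E3]

open InnerProductGeometry in
lemma ballMeasure_real_wedge {m n : E3} (h : LinearIndependent ℝ ![m, n]) :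
    ballMeasure.real ({x | 0 < ⟪m, x⟫_ℝ} ∩ {x | 0 < ⟪n, x⟫_ℝ}) =
      2 / 3 * (Real.pi - angle m n) := by
  rw [← volume_wedge h, measureReal_def, ballMeasure, Measure.restrict_apply
    ((measurableSet_openHalfSpace m).inter (measurableSet_openHalfSpace n)), measureReal_def]
  congr 2
  ext x
  simp only [mem_inter_iff, mem_ofPred_eq, mem_ball_zero_iff]
  tauto

lemma ballMeasure_real_halfSpace {n : E3} (hn : n ≠ 0) :
    ballMeasure.real {x | 0 < ⟪n, x⟫_ℝ} = 2 * Real.pi / 3 := by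
  set H := {x : E3 | 0 < ⟪n, x⟫_ℝ} with hH
  have hm : MeasurableSet H := measurableSet_openHalfSpace n
  have h1 := measureReal_add_measureReal_compl (μ := ballMeasure) hm
  have h2 : ballMeasure.real Hᶜ = ballMeasure.real (-H) := by
    refine measureReal_congr (eventuallyEq_set.mpr ?_)
    filter_upwards [ballMeasure_ae_ne hn] with x hx
    simp only [hH, mem_compl_iff, mem_ofPred_eq, Set.mem_neg, inner_neg_right, not_lt, neg_pos]
    exact ⟨fun h => lt_of_le_of_ne h hx, le_of_lt⟩
  rw [h2, ballMeasure_real_neg hm, ballMeasure_real_univ] at h1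
  linarith

open InnerProductGeometry in
-- Inclusion–exclusion together with the antipodal map, which exchanges `(A \ B) \ C` and `(B ∩ C) \
-- A` up to null sets. So the half ball has the volume of the three wedges minus twice that of the
-- trihedral region.
lemma ballMeasure_real_trihedral {n : Fin 3 → E3} (h : LinearIndependent ℝ n) :
    ballMeasure.real ({x | 0 < ⟪n 0, x⟫_ℝ} ∩ {x | 0 < ⟪n 1, x⟫_ℝ} ∩ {x | 0 < ⟪n 2, x⟫_ℝ}) =
      (2 * Real.pi - angle (n 0) (n 1) - angle (n 0) (n 2) - angle (n 1) (n 2)) / 3 := by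
  have hpair : ∀ i j : Fin 3, i ≠ j → LinearIndependent ℝ ![n i, n j] := by
    intro i j hij
    have : ![n i, n j] = n ∘ ![i, j] := by
      funext a; fin_cases a <;> rfl
    rw [this]
    refine h.comp _ ?_
    intro a b hab
    fin_cases a <;> fin_cases b <;> simp_all
  have w01 := ballMeasure_real_wedge (hpair 0 1 (by decide))
  have w02 := ballMeasure_real_wedge (hpair 0 2 (by decide))
  have w12 := ballMeasure_real_wedge (hpair 1 2 (by decide))
  have half := ballMeasure_real_halfSpace (h.ne_zero 0)
  set A := {x : E3 | 0 < ⟪n 0, x⟫_ℝ} with hA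
  set B := {x : E3 | 0 < ⟪n 1, x⟫_ℝ} with hB
  set C := {x : E3 | 0 < ⟪n 2, x⟫_ℝ} with hC
  have mA : MeasurableSet A := measurableSet_openHalfSpace _
  have mB : MeasurableSet B := measurableSet_openHalfSpace _
  have mC : MeasurableSet C := measurableSet_openHalfSpace _
  have s1 := measureReal_inter_add_sdiff (μ := ballMeasure) (s := A ∩ B) mC
  have s2 := measureReal_inter_add_sdiff (μ := ballMeasure) (s := A ∩ C) mB
  have s3 := measureReal_inter_add_sdiff (μ := ballMeasure) (s := B ∩ C) mA
  have s4 := measureReal_inter_add_sdiff (μ := ballMeasure) (s := A) mB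
  have s5 := measureReal_inter_add_sdiff (μ := ballMeasure) (s := A \ B) mC
  have e2 : A ∩ C ∩ B = A ∩ B ∩ C := by ext; simp; tauto
  have e3 : B ∩ C ∩ A = A ∩ B ∩ C := by ext; simp; tauto
  have e5 : A \ B ∩ C = (A ∩ C) \ B := by ext; simp; tauto
  have e6 : ballMeasure.real ((A \ B) \ C) = ballMeasure.real ((B ∩ C) \ A) := by
    rw [← ballMeasure_real_neg ((mB.inter mC).diff mA)]
    refine measureReal_congr (eventuallyEq_set.mpr ?_)
    filter_upwards [ballMeasure_ae_ne (h.ne_zero 0), ballMeasure_ae_ne (h.ne_zero 1),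
      ballMeasure_ae_ne (h.ne_zero 2)] with x h0 h1 h2
    simp only [hA, hB, hC, Set.mem_sdiff, mem_inter_iff, mem_ofPred_eq, Set.mem_neg, inner_neg_right,
      not_lt, neg_pos]
    constructor
    · rintro ⟨⟨a, b⟩, c⟩
      exact ⟨⟨lt_of_le_of_ne b h1, lt_of_le_of_ne c h2⟩, a.le⟩
    · rintro ⟨⟨b, c⟩, a⟩
      exact ⟨⟨lt_of_le_of_ne a h0.symm, b.le⟩, c.le⟩
  rw [e2] at s2
  rw [e3] at s3
  rw [e5, e6] at s5
  linarith

open InnerProductGeometry in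
/-- Girard's theorem: the area of the spherical triangle cut out by three half spaces. -/
theorem toSphere_real_trihedral {n : Fin 3 → E3} (h : LinearIndependent ℝ n) :
    (volume : Measure E3).toSphere.real {u | ∀ i, 0 ≤ ⟪n i, (u : E3)⟫_ℝ} =
      2 * Real.pi - angle (n 0) (n 1) - angle (n 0) (n 2) - angle (n 1) (n 2) := by
  set K : Set E3 := {x | ∀ i, 0 ≤ ⟪n i, x⟫_ℝ} with hK
  have mK : MeasurableSet K := by
    have : K = ⋂ i, {x | 0 ≤ ⟪n i, x⟫_ℝ} := by ext; simp [hK]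
    rw [this]
    exact MeasurableSet.iInter fun i => measurableSet_closedHalfSpace (n i)
  -- The spherical measure is three times the volume of the cone over the set inside the ball; the
  -- missing apex is a null set.
  have hset : Ioo (0 : ℝ) 1 • ((↑) '' {u : sphere (0 : E3) 1 | (u : E3) ∈ K} : Set E3) =
      (K ∩ ball 0 1) \ {0} := by
    ext x
    simp only [Set.mem_smul, mem_image, Set.mem_sdiff, mem_inter_iff, mem_ball_zero_iff,
      mem_singleton_iff]
    constructor
    · rintro ⟨t, ht, _, ⟨u, hu, rfl⟩, rfl⟩
      have hun : ‖(u : E3)‖ = 1 := by simp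
      refine ⟨⟨fun i => ?_, ?_⟩, ?_⟩
      · rw [real_inner_smul_right]
        exact mul_nonneg ht.1.le (hu i)
      · rw [norm_smul, hun, mul_one, Real.norm_of_nonneg ht.1.le]
        exact ht.2
      · intro h0
        have := congrArg norm h0
        rw [norm_smul, hun, mul_one, norm_zero, Real.norm_of_nonneg ht.1.le] at this
        exact ht.1.ne' this
    · rintro ⟨⟨hxK, hx1⟩, hx0⟩
      have hx : 0 < ‖x‖ := norm_pos_iff.mpr hx0
      refine ⟨‖x‖, ⟨hx, hx1⟩, ‖x‖⁻¹ • x, ⟨⟨‖x‖⁻¹ • x, by simp [norm_smul, hx.ne']⟩, ?_, rfl⟩, ?_⟩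
      · intro i
        change 0 ≤ ⟪n i, ‖x‖⁻¹ • x⟫_ℝ
        rw [real_inner_smul_right]
        exact mul_nonneg (by positivity) (hxK i)
      · rw [smul_smul, mul_inv_cancel₀ hx.ne', one_smul]
  have hs : {u : sphere (0 : E3) 1 | ∀ i, 0 ≤ ⟪n i, (u : E3)⟫_ℝ} =
      {u : sphere (0 : E3) 1 | (u : E3) ∈ K} := rfl
  have hball : ballMeasure.real K = ballMeasure.real
      ({x | 0 < ⟪n 0, x⟫_ℝ} ∩ {x | 0 < ⟪n 1, x⟫_ℝ} ∩ {x | 0 < ⟪n 2, x⟫_ℝ}) := by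
    refine measureReal_congr (eventuallyEq_set.mpr ?_)
    filter_upwards [ballMeasure_ae_ne (h.ne_zero 0), ballMeasure_ae_ne (h.ne_zero 1),
      ballMeasure_ae_ne (h.ne_zero 2)] with x h0 h1 h2
    simp only [hK, mem_ofPred_eq, mem_inter_iff, Fin.forall_fin_succ, Fin.succ_zero_eq_one,
      Fin.succ_one_eq_two]
    constructor
    · rintro ⟨a, b, c, -⟩
      exact ⟨⟨lt_of_le_of_ne a h0.symm, lt_of_le_of_ne b h1.symm⟩, lt_of_le_of_ne c h2.symm⟩
    · rintro ⟨⟨a, b⟩, c⟩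
      exact ⟨a.le, b.le, c.le, fun i => i.elim0⟩
  have mKs : MeasurableSet {u : sphere (0 : E3) 1 | (u : E3) ∈ K} := measurable_subtype_coe mK
  rw [hs, measureReal_def, Measure.toSphere_apply' _ mKs, hset,
    measure_sdiff_null (measure_singleton _), ← Measure.restrict_apply mK, ENNReal.toReal_mul]
  have h3 := ballMeasure_real_trihedral h
  rw [← hball] at h3
  change _ * ballMeasure.real K = _
  rw [h3]
  simp
  ring

end

/-! ### Edge frames, face normals and dihedral angles -/

noncomputable section

open Set Filter Topology
open MeasureTheory Metric
open scoped InnerProductSpace ENNReal Pointwise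

/-- The vectors `a j` are the edges from the vertex `0` to the other vertices in a tetrahedron
with the radii `r`. -/
def IsEdgeFrame (r : Fin 4 → ℝ) (a : Fin 3 → E3) : Prop :=
  ∀ j m, ⟪a j, a m⟫_ℝ = if j = m then (r 0 + r j.succ) ^ 2 else
    r 0 ^ 2 + r 0 * r j.succ + r 0 * r m.succ - r j.succ * r m.succ

/-- Up to a factor, the adjugate of the Gram matrix of an edge frame; `k` are the inverse radii. -/
def coGram (k : Fin 4 → ℝ) (j m : Fin 3) : ℝ :=
  k j.succ * k m.succ * (faceSum k j.succ * faceSum k m.succ +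
    if j = m then descartes k else -descartes k)

/-- The inner normals of the faces at the vertex `0`. -/
def faceNormal (k : Fin 4 → ℝ) (a : Fin 3 → E3) (j : Fin 3) : E3 := ∑ m, coGram k j m • a m

namespace IsEdgeFrame

variable {r : Fin 4 → ℝ} {a : Fin 3 → E3}

/-- The product of the Gram matrix with a multiple of its adjugate: up to the factor `4 * descartes
r⁻¹`, the normals are the dual basis of the edges. -/
lemma inner_faceNormal_edge (h : IsEdgeFrame r a) (hr : ∀ i, 0 < r i) (j m : Fin 3) :
    ⟪faceNormal r⁻¹ a j, a m⟫_ℝ = if j = m then 4 * descartes r⁻¹ else 0 := by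
  have h0 := (hr 0).ne'
  have h1 := (hr 1).ne'
  have h2 := (hr 2).ne'
  have h3 := (hr 3).ne'
  simp only [faceNormal, sum_inner, real_inner_smul_left, h _ _]
  fin_cases j <;> fin_cases m <;>
    simp [Fin.sum_univ_three, coGram, faceSum, descartes, Fin.sum_univ_four, -mul_eq_zero] <;>
    field_simp <;> ring

lemma inner_faceNormal_faceNormal (h : IsEdgeFrame r a) (hr : ∀ i, 0 < r i) (j m : Fin 3) :
    ⟪faceNormal r⁻¹ a j, faceNormal r⁻¹ a m⟫_ℝ = 4 * descartes r⁻¹ * coGram r⁻¹ m j := by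
  conv_lhs => rw [faceNormal.eq_def _ _ m]
  simp [inner_sum, real_inner_smul_right, h.inner_faceNormal_edge hr, mul_comm]

lemma coGram_self_pos {k : Fin 4 → ℝ} (hk : ∀ i, 0 < k i) (j : Fin 3) : 0 < coGram k j j := by
  have h1 := hk j.succ
  have h2 := descartes_add_faceSum_sq_pos hk j.succ
  rw [coGram, if_pos rfl]
  exact mul_pos (mul_pos h1 h1) (by nlinarith)

/-- The squared length of a normal is `4 * descartes r⁻¹` times a diagonal entry of `coGram`. That
entry is positive for all positive radii, so the normal is nonzero by independence and the other
factor must be positive. -/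
lemma descartes_pos (h : IsEdgeFrame r a) (hr : ∀ i, 0 < r i) (ha : LinearIndependent ℝ a) :
    0 < descartes r⁻¹ := by
  have hk : ∀ i, 0 < r⁻¹ i := fun i => inv_pos.mpr (hr i)
  have hM := coGram_self_pos hk 0
  have hne : faceNormal r⁻¹ a 0 ≠ 0 := fun h0 =>
    hM.ne' (Fintype.linearIndependent_iff.mp ha _ h0 0)
  have := real_inner_self_pos.mpr hne
  rw [h.inner_faceNormal_faceNormal hr] at this
  have := pos_of_mul_pos_left this hM.le
  linarith

lemma linearIndependent (h : IsEdgeFrame r a) (hr : ∀ i, 0 < r i) (hQ : 0 < descartes r⁻¹) :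
    LinearIndependent ℝ a := by
  refine Fintype.linearIndependent_iff.mpr fun c hc j => ?_
  have := congrArg (fun x => ⟪faceNormal r⁻¹ a j, x⟫_ℝ) hc
  simp only [inner_sum, real_inner_smul_right, h.inner_faceNormal_edge hr, inner_zero_right,
    mul_ite, mul_zero, Finset.sum_ite_eq, Finset.mem_univ, if_true] at this
  exact (mul_eq_zero.mp this).resolve_right (by positivity)

lemma linearIndependent_faceNormal (h : IsEdgeFrame r a) (hr : ∀ i, 0 < r i)
    (hQ : 0 < descartes r⁻¹) : LinearIndependent ℝ (faceNormal r⁻¹ a) := by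
  refine Fintype.linearIndependent_iff.mpr fun c hc j => ?_
  have := congrArg (fun x => ⟪x, a j⟫_ℝ) hc
  simp only [sum_inner, real_inner_smul_left, h.inner_faceNormal_edge hr, inner_zero_left,
    mul_ite, mul_zero, Finset.sum_ite_eq', Finset.mem_univ, if_true] at this
  exact (mul_eq_zero.mp this).resolve_right (by positivity)

end IsEdgeFrame

section FaceAngle

variable {k : Fin 4 → ℝ}

lemma sin_faceAngle (hQ : 0 < descartes k) (j : Fin 4) :
    Real.sin (faceAngle k j) = faceSum k j / √(descartes k + faceSum k j ^ 2) := by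
  have hE : 0 < descartes k + faceSum k j ^ 2 := by positivity
  have hs := Real.sqrt_pos.mpr hE
  have h1 : |faceSum k j| ≤ √(descartes k + faceSum k j ^ 2) := by
    rw [← Real.sqrt_sq_eq_abs]
    exact Real.sqrt_le_sqrt (by linarith)
  obtain ⟨h2, h3⟩ := abs_le.mp h1
  exact Real.sin_arcsin ((le_div_iff₀ hs).mpr (by linarith)) ((div_le_one hs).mpr h3)

lemma cos_faceAngle (hQ : 0 < descartes k) (j : Fin 4) :
    Real.cos (faceAngle k j) = √(descartes k) / √(descartes k + faceSum k j ^ 2) := by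
  have hE : 0 < descartes k + faceSum k j ^ 2 := by positivity
  rw [faceAngle, Real.cos_arcsin, ← Real.sqrt_div hQ.le, div_pow, Real.sq_sqrt hE.le]
  congr 1
  field_simp
  ring

/-- The two face sums add up to twice the sum of the other two entries. With `faceAngle_add_le` this
puts the sum of the angles into the range where it is determined by its cosine. -/
lemma faceAngle_add_nonneg (hk : ∀ i, 0 < k i) (hQ : 0 < descartes k) {i j : Fin 4}
    (hij : i ≠ j) : 0 ≤ faceAngle k i + faceAngle k j := by
  have hs := Real.sqrt_pos.mpr hQ
  have hP : 0 ≤ faceSum k i + faceSum k j := by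
    have h : k i + k j ≤ ∑ m, k m := by
      rw [← Finset.sum_pair hij]
      exact Finset.sum_le_sum_of_subset_of_nonneg (Finset.subset_univ _) fun m _ _ => (hk m).le
    simp only [faceSum]
    linarith
  rw [faceAngle_eq_arctan hQ, faceAngle_eq_arctan hQ, ← neg_le_iff_add_nonneg, ← Real.arctan_neg,
    Real.arctan_le_arctan_iff, ← neg_div]
  exact div_le_div_of_nonneg_right (by linarith) hs.le

lemma faceAngle_add_le (i j : Fin 4) : faceAngle k i + faceAngle k j ≤ Real.pi := by
  have h1 := Real.arcsin_le_pi_div_two (faceSum k i / √(descartes k + faceSum k i ^ 2))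
  have h2 := Real.arcsin_le_pi_div_two (faceSum k j / √(descartes k + faceSum k j ^ 2))
  simp only [faceAngle]
  linarith

end FaceAngle

namespace IsEdgeFrame

variable {r : Fin 4 → ℝ} {a : Fin 3 → E3}

/-- The dihedral angle between two faces is the sum of the corresponding face angles. -/
lemma angle_faceNormal (h : IsEdgeFrame r a) (hr : ∀ i, 0 < r i) (hQ : 0 < descartes r⁻¹)
    {j m : Fin 3} (hjm : j ≠ m) :
    InnerProductGeometry.angle (faceNormal r⁻¹ a j) (faceNormal r⁻¹ a m) =
      Real.pi - (faceAngle r⁻¹ j.succ + faceAngle r⁻¹ m.succ) := by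
  have hk : ∀ i, 0 < r⁻¹ i := fun i => inv_pos.mpr (hr i)
  have hnorm : ∀ j, ‖faceNormal r⁻¹ a j‖ = 2 * √(descartes r⁻¹) * r⁻¹ j.succ *
      √(descartes r⁻¹ + faceSum r⁻¹ j.succ ^ 2) := by
    intro j
    have hE := (descartes_add_faceSum_sq_pos hk j.succ).le
    have hj := (hk j.succ).le
    rw [norm_eq_sqrt_real_inner, h.inner_faceNormal_faceNormal hr, Real.sqrt_eq_iff_eq_sq
      (mul_nonneg (by positivity) (coGram_self_pos hk j).le) (by positivity)]
    simp only [mul_pow, Real.sq_sqrt hQ.le, Real.sq_sqrt hE, coGram, if_true]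
    ring
  have hinner : ⟪faceNormal r⁻¹ a j, faceNormal r⁻¹ a m⟫_ℝ = 4 * descartes r⁻¹ *
      (r⁻¹ j.succ * r⁻¹ m.succ * (faceSum r⁻¹ j.succ * faceSum r⁻¹ m.succ - descartes r⁻¹)) := by
    rw [h.inner_faceNormal_faceNormal hr, coGram, if_neg hjm.symm]
    ring
  have hne : j.succ ≠ m.succ := fun e => hjm (Fin.succ_injective _ e)
  have hcos : Real.cos (Real.pi - (faceAngle r⁻¹ j.succ + faceAngle r⁻¹ m.succ)) =
      ⟪faceNormal r⁻¹ a j, faceNormal r⁻¹ a m⟫_ℝ /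
        (‖faceNormal r⁻¹ a j‖ * ‖faceNormal r⁻¹ a m‖) := by
    rw [hnorm, hnorm, hinner, Real.cos_pi_sub, Real.cos_add, sin_faceAngle hQ, sin_faceAngle hQ,
      cos_faceAngle hQ, cos_faceAngle hQ]
    have hEj := Real.sqrt_pos.mpr (descartes_add_faceSum_sq_pos hk j.succ)
    have hEm := Real.sqrt_pos.mpr (descartes_add_faceSum_sq_pos hk m.succ)
    have hs := Real.sqrt_pos.mpr hQ
    have hkj := hk j.succ
    have hkm := hk m.succ
    have hs2 := Real.sq_sqrt hQ.le
    generalize √(descartes r⁻¹ + faceSum r⁻¹ j.succ ^ 2) = x at *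
    generalize √(descartes r⁻¹ + faceSum r⁻¹ m.succ ^ 2) = y at *
    generalize √(descartes r⁻¹) = s at *
    generalize r⁻¹ j.succ = kj at *
    generalize r⁻¹ m.succ = km at *
    rw [← hs2]
    field_simp
    ring
  rw [InnerProductGeometry.angle, ← hcos, Real.arccos_cos]
  · linarith [faceAngle_add_le (k := r⁻¹) j.succ m.succ]
  · linarith [faceAngle_add_nonneg hk hQ hne]

/-- By duality the cone over the edges is the intersection of the half spaces of the face normals.
In Girard's formula each of the three face angles occurs in two dihedral angles, whence the factor
two in `vertexAngle`. -/
theorem toSphere_real_cone (h : IsEdgeFrame r a) (hr : ∀ i, 0 < r i) (ha : LinearIndependent ℝ a) :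
    (volume : Measure E3).toSphere.real
      {u | ∃ c : Fin 3 → ℝ, (∀ j, 0 ≤ c j) ∧ (u : E3) = ∑ j, c j • a j} = vertexAngle r 0 := by
  have hQ := h.descartes_pos hr ha
  have hset : {u : sphere (0 : E3) 1 | ∃ c : Fin 3 → ℝ, (∀ j, 0 ≤ c j) ∧
      (u : E3) = ∑ j, c j • a j} =
      {u : sphere (0 : E3) 1 | ∀ j, 0 ≤ ⟪faceNormal r⁻¹ a j, (u : E3)⟫_ℝ} := by
    have hinner : ∀ (c : Fin 3 → ℝ) j, ⟪faceNormal r⁻¹ a j, ∑ m, c m • a m⟫_ℝ =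
        c j * (4 * descartes r⁻¹) := by
      intro c j
      simp [inner_sum, real_inner_smul_right, h.inner_faceNormal_edge hr]
    ext u
    simp only [mem_ofPred_eq]
    constructor
    · rintro ⟨c, hc, hu⟩ j
      rw [hu, hinner]
      have := hc j
      positivity
    · intro hu
      have hspan : (u : E3) ∈ Submodule.span ℝ (range a) := by
        rw [ha.span_eq_top_of_card_eq_finrank (by simp)]
        exact Submodule.mem_top
      obtain ⟨c, hc⟩ := (Submodule.mem_span_range_iff_exists_fun ℝ).mp hspan
      refine ⟨c, fun j => ?_, hc.symm⟩
      have := hu j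
      rw [← hc, hinner] at this
      exact nonneg_of_mul_nonneg_left this (by positivity)
  rw [hset, toSphere_real_trihedral (h.linearIndependent_faceNormal hr hQ),
    h.angle_faceNormal hr hQ (by decide), h.angle_faceNormal hr hQ (by decide),
    h.angle_faceNormal hr hQ (by decide)]
  simp only [vertexAngle, Fin.sum_univ_four, Fin.succ_zero_eq_one, Fin.succ_one_eq_two]
  have : (2 : Fin 3).succ = 3 := rfl
  rw [this]
  ring

end IsEdgeFrame

/-- A Cholesky factorization of the prescribed Gram matrix: `d`, `e`, `f` are its off-diagonal
entries, `m` and `D` the Gram determinants of the first two and of all three edges. The last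
coordinate `√D / √m` is where positivity of the Descartes form enters. -/
lemma exists_isEdgeFrame {r : Fin 4 → ℝ} (hr : ∀ i, 0 < r i) (hQ : 0 < descartes r⁻¹) :
    ∃ a, IsEdgeFrame r a := by
  have h0 := hr 0
  have h1 := hr 1
  have h2 := hr 2
  have h3 := hr 3
  obtain ⟨l, hl⟩ : ∃ l, l = r 0 + r 1 := ⟨_, rfl⟩
  obtain ⟨d, hd⟩ : ∃ d, d = r 0 ^ 2 + r 0 * r 1 + r 0 * r 2 - r 1 * r 2 := ⟨_, rfl⟩
  obtain ⟨e, he⟩ : ∃ e, e = r 0 ^ 2 + r 0 * r 1 + r 0 * r 3 - r 1 * r 3 := ⟨_, rfl⟩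
  obtain ⟨f, hf⟩ : ∃ f, f = r 0 ^ 2 + r 0 * r 2 + r 0 * r 3 - r 2 * r 3 := ⟨_, rfl⟩
  obtain ⟨m, hm⟩ : ∃ m, m = 4 * r 0 * r 1 * r 2 * (r 0 + r 1 + r 2) := ⟨_, rfl⟩
  obtain ⟨D, hD⟩ : ∃ D, D = 4 * (r 0 * r 1 * r 2 * r 3) ^ 2 * descartes r⁻¹ := ⟨_, rfl⟩
  have hl0 : 0 < l := by rw [hl]; positivity
  have hm0 : 0 < m := by rw [hm]; positivity
  have hD0 : 0 < D := by rw [hD]; positivity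
  have hD' : D = 4 * ((r 1 * r 2 * r 3 + r 0 * r 2 * r 3 + r 0 * r 1 * r 3 + r 0 * r 1 * r 2) ^ 2 -
      2 * ((r 1 * r 2 * r 3) ^ 2 + (r 0 * r 2 * r 3) ^ 2 + (r 0 * r 1 * r 3) ^ 2 +
        (r 0 * r 1 * r 2) ^ 2)) := by
    rw [hD]
    simp only [descartes, Fin.sum_univ_four, Pi.inv_apply]
    field_simp
  set s := √m with hs
  have hs0 : 0 < s := Real.sqrt_pos.mpr hm0
  have hs2 : s ^ 2 = m := Real.sq_sqrt hm0.le
  set z := √D with hz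
  have hz2 : z ^ 2 = D := Real.sq_sqrt hD0.le
  have e1 : d ^ 2 + s ^ 2 = l ^ 2 * (r 0 + r 2) ^ 2 := by
    rw [hs2, hm, hl, hd]; ring
  have e2 : m * e ^ 2 + (l ^ 2 * f - d * e) ^ 2 + l ^ 2 * D = l ^ 2 * m * (r 0 + r 3) ^ 2 := by
    rw [hD', hm, hl, hd, he, hf]; ring
  refine ⟨![!₂[l, 0, 0], !₂[d / l, s / l, 0], !₂[e / l, (l ^ 2 * f - d * e) / (l * s), z / s]],
    ?_⟩
  have i01 : l * (d / l) = d := by field_simp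
  have i02 : l * (e / l) = e := by field_simp
  have i11 : d / l * (d / l) + s / l * (s / l) = (r 0 + r 2) ^ 2 := by
    field_simp; linarith
  have i12 : d / l * (e / l) + s / l * ((l ^ 2 * f - d * e) / (l * s)) = f := by
    field_simp; ring
  have i22 : e / l * (e / l) + (l ^ 2 * f - d * e) / (l * s) * ((l ^ 2 * f - d * e) / (l * s)) +
      z / s * (z / s) = (r 0 + r 3) ^ 2 := by
    field_simp
    rw [hs2, hz2]
    linarith
  intro j k
  have t2 : (2 : Fin 3).succ = 3 := rfl
  fin_cases j <;> fin_cases k <;>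
    simp only [Fin.zero_eta, Fin.mk_one, Fin.reduceFinMk, PiLp.inner_apply, Fin.sum_univ_three,
      Matrix.cons_val_zero, Matrix.cons_val_one, Matrix.cons_val, RCLike.inner_apply, conj_trivial,
      Fin.succ_zero_eq_one, Fin.succ_one_eq_two, t2, Fin.reduceEq, if_true, if_false, ← hl]
  all_goals linarith

end

/-! ### Solid angles of realized tetrahedra -/

noncomputable section

open Set Filter Topology
open MeasureTheory Metric
open scoped InnerProductSpace ENNReal Pointwise

section TetrahedronAngles

variable {V : Type*} {τ : Finset V}

lemma sum_comp_equiv {A : Type*} [AddCommMonoid A] (E : Fin 4 ≃ τ) (f : V → A) :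
    ∑ i, f (E i) = ∑ j ∈ τ, f j := by
  rw [Equiv.sum_comp E fun j : τ => f j, Finset.sum_coe_sort]

/-- The edges of a realization that start at the vertex with the number `0`. -/
def edgeFrame (E : Fin 4 ≃ τ) (p : V → E3) (j : Fin 3) : E3 := p (E j.succ) - p (E 0)

namespace IsRealization

variable {r : V → ℝ} {p : V → E3}

lemma isEdgeFrame (h : IsRealization τ r p) (E : Fin 4 ≃ τ) :
    IsEdgeFrame (fun i => r (E i)) (edgeFrame E p) := by
  have hd : ∀ i j : Fin 4, i ≠ j → dist (p (E i)) (p (E j)) = r (E i) + r (E j) := fun i j hij =>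
    h.2 _ (E i).2 _ (E j).2 fun e => hij (E.injective (Subtype.ext e))
  have hn : ∀ j : Fin 3, ‖edgeFrame E p j‖ = r (E 0) + r (E j.succ) := fun j => by
    rw [edgeFrame, ← dist_eq_norm, hd _ _ (Fin.succ_ne_zero j), add_comm]
  intro j m
  split_ifs with hjm
  · rw [← hjm, real_inner_self_eq_norm_sq, hn]
  · have hne : ‖edgeFrame E p j - edgeFrame E p m‖ = r (E j.succ) + r (E m.succ) := by
      rw [edgeFrame, edgeFrame, sub_sub_sub_cancel_right, ← dist_eq_norm,
        hd _ _ fun e => hjm (Fin.succ_injective _ e)]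
    rw [real_inner_eq_norm_mul_self_add_norm_mul_self_sub_norm_sub_mul_self_div_two, hne, hn, hn]
    ring

lemma linearIndependent (h : IsRealization τ r p) (E : Fin 4 ≃ τ) :
    LinearIndependent ℝ (edgeFrame E p) := by
  have h1 : AffineIndependent ℝ fun i : Fin 4 => p (E i) := h.1.comp_embedding E.toEmbedding
  have h2 := (affineIndependent_iff_linearIndependent_vsub ℝ _ (0 : Fin 4)).mp h1
  exact h2.comp (fun j : Fin 3 => ⟨j.succ, Fin.succ_ne_zero j⟩) fun a b hab =>
    Fin.succ_injective _ (congrArg Subtype.val hab)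

end IsRealization

lemma sum_smul_edgeFrame (E : Fin 4 ≃ τ) (p : V → E3) (c : V → ℝ) :
    ∑ j ∈ τ, c j • (p j - p (E 0)) = ∑ j : Fin 3, c (E j.succ) • edgeFrame E p j := by
  rw [← sum_comp_equiv E fun j => c j • (p j - p (E 0)), Fin.sum_univ_succ]
  simp [edgeFrame]

lemma mem_vertexCone_iff (E : Fin 4 ≃ τ) (p : V → E3) (x : E3) :
    x ∈ vertexCone τ p (E 0) ↔
      ∃ c : Fin 3 → ℝ, (∀ j, 0 ≤ c j) ∧ x = ∑ j, c j • edgeFrame E p j := by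
  constructor
  · rintro ⟨c, hc, hx⟩
    exact ⟨fun j => c (E j.succ), fun j => hc _, hx.trans (sum_smul_edgeFrame E p c)⟩
  · rintro ⟨c, hc, hx⟩
    have hinj : Function.Injective fun i => (E i : V) := Subtype.val_injective.comp E.injective
    set c' : V → ℝ := Function.extend (fun i => (E i : V)) (Fin.cons 0 c) 0 with hc'
    have hE : ∀ i, c' (E i) = (Fin.cons 0 c : Fin 4 → ℝ) i := fun i => hinj.extend_apply _ _ i
    refine ⟨c', fun v => ?_, ?_⟩
    · by_cases hv : ∃ i, (E i : V) = v
      · obtain ⟨i, rfl⟩ := hv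
        rw [hE]
        refine Fin.cases ?_ (fun j => ?_) i
        · simp
        · simpa using hc j
      · rw [hc', Function.extend_apply' _ _ _ hv, Pi.zero_apply]
    · rw [sum_smul_edgeFrame, hx]
      simp [hE]

lemma solidAngleAt_zero {r : V → ℝ} {p : V → E3} (hr : ∀ i, 0 < r i) (h : IsRealization τ r p)
    (E : Fin 4 ≃ τ) : solidAngleAt τ p (E 0) = vertexAngle (fun i => r (E i)) 0 := by
  rw [← (h.isEdgeFrame E).toSphere_real_cone (fun i => hr _) (h.linearIndependent E), solidAngleAt]
  simp only [mem_vertexCone_iff]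

/-- This turns the geometric condition into an inequality, from which openness and scaling
invariance of the realizable radii follow. -/
lemma exists_isRealization_iff {r : V → ℝ} (hr : ∀ i, 0 < r i) (E : Fin 4 ≃ τ) :
    (∃ p : V → E3, IsRealization τ r p) ↔ 0 < descartes (fun i => r (E i))⁻¹ := by
  constructor
  · rintro ⟨p, h⟩
    exact (h.isEdgeFrame E).descartes_pos (fun i => hr _) (h.linearIndependent E)
  · intro hQ
    obtain ⟨a, ha⟩ := exists_isEdgeFrame (r := fun i => r (E i)) (fun i => hr _) hQ
    have hli := ha.linearIndependent (fun i => hr _) hQ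
    have hinj : Function.Injective fun i => (E i : V) := Subtype.val_injective.comp E.injective
    set q : Fin 4 → E3 := Fin.cons 0 a with hq
    set p : V → E3 := Function.extend (fun i => (E i : V)) q 0 with hp
    have hE : ∀ i, p (E i) = q i := fun i => hinj.extend_apply _ _ i
    refine ⟨p, ?_, ?_⟩
    · have hqa : AffineIndependent ℝ q := by
        rw [affineIndependent_iff_linearIndependent_vsub ℝ _ (0 : Fin 4)]
        have e : (fun i : {x : Fin 4 // x ≠ 0} => q i -ᵥ q 0) =
            a ∘ fun i : {x : Fin 4 // x ≠ 0} => (i : Fin 4).pred i.2 := by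
          funext ⟨i, hi⟩
          obtain ⟨j, rfl⟩ := Fin.exists_succ_eq.mpr hi
          simp [hq]
        rw [e]
        exact hli.comp _ fun x y hxy => Subtype.ext (Fin.pred_inj.mp hxy)
      have : (fun j : τ => p j) = q ∘ E.symm := by
        funext j
        rw [Function.comp_apply, ← hE, Equiv.apply_symm_apply]
      rw [this]
      exact hqa.comp_embedding E.symm.toEmbedding
    · have hnorm : ∀ j, ‖a j‖ = r (E 0) + r (E j.succ) := fun j => by
        have := ha j j
        rw [if_pos rfl, real_inner_self_eq_norm_sq] at this
        exact (sq_eq_sq₀ (norm_nonneg _) (add_pos (hr _) (hr _)).le).mp this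
      have hdiff : ∀ j m, j ≠ m → ‖a j - a m‖ = r (E j.succ) + r (E m.succ) := fun j m hjm => by
        refine (sq_eq_sq₀ (norm_nonneg _) (add_pos (hr _) (hr _)).le).mp ?_
        rw [norm_sub_sq_real, ha j m, if_neg hjm, hnorm, hnorm]
        ring
      have hdist : ∀ i j : Fin 4, i ≠ j → dist (q i) (q j) = r (E i) + r (E j) := by
        intro i j
        refine Fin.cases ?_ (fun i => ?_) i <;> refine Fin.cases ?_ (fun j => ?_) j
        · exact fun h => absurd rfl h
        · intro _
          simp [hq, hnorm]
        · intro _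
          simp [hq, hnorm, add_comm]
        · intro hij
          simpa [hq, dist_eq_norm] using hdiff i j fun e => hij (congrArg Fin.succ e)
      intro j hj k hk hjk
      obtain ⟨i, hi⟩ := E.surjective ⟨j, hj⟩
      obtain ⟨m, hm⟩ := E.surjective ⟨k, hk⟩
      have hi' : j = E i := by rw [hi]
      have hm' : k = E m := by rw [hm]
      subst hi'
      subst hm'
      rw [hE, hE]
      exact hdist i m fun e => hjk (by rw [e])

/-- The positive vectors of radii for which the tetrahedron `τ` exists. -/
def realizableRadii (τ : Finset V) : Set (V → ℝ) :=
  {r | (∀ i, 0 < r i) ∧ ∃ p : V → E3, IsRealization τ r p}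

lemma mem_realizableRadii_iff (E : Fin 4 ≃ τ) {r : V → ℝ} :
    r ∈ realizableRadii τ ↔ (∀ i, 0 < r i) ∧ 0 < descartes (fun i => r (E i))⁻¹ :=
  and_congr_right fun hr => exists_isRealization_iff hr E

/-- The geometry was done at the vertex with number `0`; a transposition brings any other vertex
there, and `vertexAngle` is equivariant under renumbering. -/
lemma solidAngle_eq_vertexAngle {r : V → ℝ} (h : r ∈ realizableRadii τ) (E : Fin 4 ≃ τ)
    (i : Fin 4) : solidAngle τ r (E i) = vertexAngle (fun i => r (E i)) i := by
  rw [solidAngle, dif_pos h.2]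
  have := solidAngleAt_zero h.1 h.2.choose_spec ((Equiv.swap 0 i).trans E)
  rw [Equiv.trans_apply, Equiv.swap_apply_left] at this
  rw [this]
  have e := vertexAngle_comp_perm (fun i => r (E i)) (Equiv.swap 0 i) 0
  rw [Equiv.swap_apply_left] at e
  exact e

lemma solidAngle_nonneg (τ : Finset V) (r : V → ℝ) (i : V) : 0 ≤ solidAngle τ r i := by
  rw [solidAngle]
  split_ifs
  · exact measureReal_nonneg
  · exact le_rfl

lemma solidAngle_le (τ : Finset V) (r : V → ℝ) (i : V) : solidAngle τ r i ≤ 4 * Real.pi := by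
  rw [solidAngle]
  split_ifs
  · refine (measureReal_mono (subset_univ _)).trans ?_
    rw [Measure.toSphere_real_apply_univ, volume_real_ball_E3]
    simp
    linarith
  · positivity

lemma sum_solidAngle_mul {r : V → ℝ} (h : r ∈ realizableRadii τ) (w : V → ℝ) (E : Fin 4 ≃ τ) :
    ∑ j ∈ τ, solidAngle τ r j * w j = ∑ i, vertexAngle (fun i => r (E i)) i * w (E i) := by
  rw [← sum_comp_equiv E fun j => solidAngle τ r j * w j]
  simp only [solidAngle_eq_vertexAngle h E]

lemma sum_solidAngle_sub_mul {r r' : V → ℝ} (h : r ∈ realizableRadii τ)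
    (h' : r' ∈ realizableRadii τ) (E : Fin 4 ≃ τ) :
    ∑ j ∈ τ, (solidAngle τ r' j - solidAngle τ r j) * (r' j - r j) =
      ∑ i, (vertexAngle (fun i => r' (E i)) i - vertexAngle (fun i => r (E i)) i) *
        (r' (E i) - r (E i)) := by
  rw [← sum_comp_equiv E fun j => (solidAngle τ r' j - solidAngle τ r j) * (r' j - r j)]
  simp only [solidAngle_eq_vertexAngle h E, solidAngle_eq_vertexAngle h' E]

/-- A numbering of the vertices of a tetrahedron. -/
def vertexNumbering (hτ : τ.card = 4) : Fin 4 ≃ τ := (Finset.equivFinOfCardEq hτ).symm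

theorem sum_solidAngle_sub_mul_nonpos (hτ : τ.card = 4) {r r' : V → ℝ}
    (h : r ∈ realizableRadii τ) (h' : r' ∈ realizableRadii τ) :
    ∑ j ∈ τ, (solidAngle τ r' j - solidAngle τ r j) * (r' j - r j) ≤ 0 := by
  rw [sum_solidAngle_sub_mul h h' (vertexNumbering hτ)]
  exact sum_vertexAngle_sub_mul_nonpos (fun i => h.1 _) (fun i => h'.1 _)

theorem exists_eq_mul_of_sum_solidAngle_sub_mul_eq_zero (hτ : τ.card = 4) {r r' : V → ℝ}
    (h : r ∈ realizableRadii τ) (h' : r' ∈ realizableRadii τ)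
    (h0 : ∑ j ∈ τ, (solidAngle τ r' j - solidAngle τ r j) * (r' j - r j) = 0) :
    ∃ c : ℝ, ∀ j ∈ τ, r' j = c * r j := by
  set E := vertexNumbering hτ
  rw [sum_solidAngle_sub_mul h h' E] at h0
  obtain ⟨c, hc⟩ := eq_smul_of_sum_vertexAngle_sub_mul_eq_zero (fun i => h.1 _) (fun i => h'.1 _)
    ((mem_realizableRadii_iff E).mp h).2 h0
  refine ⟨c, fun j hj => ?_⟩
  obtain ⟨i, hi⟩ := E.surjective ⟨j, hj⟩
  have := congrFun hc i
  simpa [hi] using this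

lemma smul_mem_realizableRadii (hτ : τ.card = 4) {r : V → ℝ} (h : r ∈ realizableRadii τ)
    {c : ℝ} (hc : 0 < c) : c • r ∈ realizableRadii τ := by
  rw [mem_realizableRadii_iff (vertexNumbering hτ)] at h ⊢
  refine ⟨fun i => mul_pos hc (h.1 i), ?_⟩
  have e : (fun i => (c • r) (vertexNumbering hτ i))⁻¹ =
      c⁻¹ • (fun i => r (vertexNumbering hτ i))⁻¹ := by
    funext i; simp [mul_comm]
  rw [e, descartes_smul]
  exact mul_pos (pow_pos (inv_pos.mpr hc) 2) h.2

lemma solidAngle_smul (hτ : τ.card = 4) {r : V → ℝ} (h : r ∈ realizableRadii τ)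
    {c : ℝ} (hc : 0 < c) {j : V} (hj : j ∈ τ) : solidAngle τ (c • r) j = solidAngle τ r j := by
  set E := vertexNumbering hτ
  obtain ⟨i, hi⟩ := E.surjective ⟨j, hj⟩
  obtain rfl : j = E i := by rw [hi]
  rw [solidAngle_eq_vertexAngle h, solidAngle_eq_vertexAngle (smul_mem_realizableRadii hτ h hc)]
  exact vertexAngle_smul hc _ i

lemma one_mem_realizableRadii (hτ : τ.card = 4) : (fun _ => 1) ∈ realizableRadii τ := by
  rw [mem_realizableRadii_iff (vertexNumbering hτ)]
  refine ⟨fun i => zero_lt_one, ?_⟩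
  simp [descartes]
  norm_num

lemma isOpen_realizableRadii [Finite V] (hτ : τ.card = 4) : IsOpen (realizableRadii τ) := by
  rw [isOpen_iff_mem_nhds]
  intro r h
  set E := vertexNumbering hτ
  rw [mem_realizableRadii_iff E] at h
  have hinv : ContinuousAt (fun r : V → ℝ => (fun i => r (E i))⁻¹) r :=
    continuousAt_pi.mpr fun i => (continuous_apply (E i : V)).continuousAt.inv₀ (h.1 _).ne'
  filter_upwards [eventually_all.mpr fun i : V =>
      (continuous_apply i).continuousAt.eventually (lt_mem_nhds (h.1 i)),
    (continuous_descartes.continuousAt.comp hinv).eventually (lt_mem_nhds h.2)] with r' h1 h2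
  exact (mem_realizableRadii_iff E).mpr ⟨h1, h2⟩

lemma differentiableAt_solidAngle [Fintype V] (hτ : τ.card = 4) {r : V → ℝ}
    (h : r ∈ realizableRadii τ) {j : V} (hj : j ∈ τ) :
    DifferentiableAt ℝ (fun r => solidAngle τ r j) r := by
  set E := vertexNumbering hτ
  obtain ⟨i, hi⟩ := E.surjective ⟨j, hj⟩
  obtain rfl : j = E i := by rw [hi]
  have hev : (fun r => solidAngle τ r (E i)) =ᶠ[𝓝 r]
      fun r => vertexAngle (fun i => r (E i)) i := by
    filter_upwards [(isOpen_realizableRadii hτ).mem_nhds h] with r' h'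
    exact solidAngle_eq_vertexAngle h' E i
  refine DifferentiableAt.congr_of_eventuallyEq ?_ hev
  exact DifferentiableAt.comp (g := fun r => vertexAngle r i) (f := fun (r : V → ℝ) i => r (E i)) r
    (differentiableAt_vertexAngle (fun i => h.1 _) ((mem_realizableRadii_iff E).mp h).2 i)
    (by fun_prop)

theorem hasDerivAt_sum_solidAngle_mul_radius [Fintype V] (hτ : τ.card = 4) {r : V → ℝ}
    (h : r ∈ realizableRadii τ) (v : V → ℝ) :
    HasDerivAt (fun t : ℝ => ∑ j ∈ τ, solidAngle τ (r + t • v) j * r j) 0 0 := by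
  set E := vertexNumbering hτ
  have hline : ContinuousAt (fun t : ℝ => r + t • v) 0 := by fun_prop
  have h0 : r + (0 : ℝ) • v ∈ realizableRadii τ := by simpa using h
  have hev : (fun t : ℝ => ∑ j ∈ τ, solidAngle τ (r + t • v) j * r j) =ᶠ[𝓝 0]
      fun t : ℝ => ∑ i, vertexAngle ((fun i => r (E i)) + t • fun i => v (E i)) i * r (E i) := by
    filter_upwards [hline.preimage_mem_nhds ((isOpen_realizableRadii hτ).mem_nhds h0)] with t ht
    exact sum_solidAngle_mul ht r E
  exact (hasDerivAt_sum_vertexAngle_mul_radius (fun i => h.1 _)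
    ((mem_realizableRadii_iff E).mp h).2 _).congr_of_eventuallyEq hev

end TetrahedronAngles

end

/-! ### Curvature and the functional on the triangulation -/

noncomputable section

open Set Filter Topology

namespace Triangulation

variable {M : Type*} [TopologicalSpace M] {V : Type*} [Fintype V] (T : Triangulation M V)

lemma mem_realizableRadii {r : V → ℝ} (h : r ∈ T.ballPackings) {τ : Finset V}
    (hτ : τ ∈ T.tets) : r ∈ realizableRadii τ := ⟨h.1, h.2 τ hτ⟩

lemma isOpen_ballPackings : IsOpen T.ballPackings := by
  have e : T.ballPackings = (⋂ i, {r : V → ℝ | 0 < r i}) ∩ ⋂ τ ∈ T.tets, realizableRadii τ := by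
    ext r
    simp only [ballPackings, realizableRadii, mem_inter_iff, mem_iInter, mem_ofPred_eq]
    exact ⟨fun h => ⟨h.1, fun τ hτ => ⟨h.1, h.2 τ hτ⟩⟩, fun h => ⟨h.1, fun τ hτ => (h.2 τ hτ).2⟩⟩
  rw [e]
  refine (isOpen_iInter_of_finite fun i => isOpen_lt continuous_const (continuous_apply i)).inter ?_
  exact isOpen_biInter_finset fun τ hτ => isOpen_realizableRadii (T.card_tet τ hτ)

lemma one_mem_ballPackings : (fun _ => 1) ∈ T.ballPackings :=
  ⟨fun _ => zero_lt_one, fun τ hτ => (one_mem_realizableRadii (T.card_tet τ hτ)).2⟩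

lemma smul_mem_ballPackings {r : V → ℝ} (h : r ∈ T.ballPackings) {c : ℝ} (hc : 0 < c) :
    c • r ∈ T.ballPackings :=
  ⟨fun i => mul_pos hc (h.1 i), fun τ hτ =>
    (smul_mem_realizableRadii (T.card_tet τ hτ) (T.mem_realizableRadii h hτ) hc).2⟩

open Classical in
lemma curvature_smul {r : V → ℝ} (h : r ∈ T.ballPackings) {c : ℝ} (hc : 0 < c) (i : V) :
    T.curvature (c • r) i = T.curvature r i := by
  unfold curvature
  congr 1
  refine Finset.sum_congr rfl fun τ hτ => ?_
  rw [Finset.mem_filter] at hτ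
  exact solidAngle_smul (T.card_tet τ hτ.1) (T.mem_realizableRadii h hτ.1) hc hτ.2

lemma crg_smul {r : V → ℝ} (h : r ∈ T.ballPackings) {c : ℝ} (hc : 0 < c) :
    T.crg (c • r) = T.crg r := by
  simp only [crg, T.curvature_smul h hc, Pi.smul_apply, smul_eq_mul, ← Finset.mul_sum,
    mul_left_comm _ c]
  exact mul_div_mul_left _ _ hc.ne'

open Classical in
lemma sum_sum_filter_mem (f : Finset V → V → ℝ) :
    ∑ i, ∑ τ ∈ T.tets with i ∈ τ, f τ i = ∑ τ ∈ T.tets, ∑ i ∈ τ, f τ i := by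
  simp only [Finset.sum_filter]
  rw [Finset.sum_comm]
  refine Finset.sum_congr rfl fun τ _ => ?_
  rw [← Finset.sum_filter]
  congr 1
  ext i
  simp

lemma sum_curvature_mul (r w : V → ℝ) :
    ∑ i, T.curvature r i * w i =
      4 * Real.pi * ∑ i, w i - ∑ τ ∈ T.tets, ∑ j ∈ τ, solidAngle τ r j * w j := by
  simp only [curvature, sub_mul, Finset.sum_sub_distrib, Finset.sum_mul, Finset.mul_sum]
  rw [T.sum_sum_filter_mem fun τ i => solidAngle τ r i * w i]

lemma sum_curvature_sub_mul (r r' : V → ℝ) :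
    ∑ i, (T.curvature r' i - T.curvature r i) * (r' i - r i) =
      -∑ τ ∈ T.tets, ∑ j ∈ τ, (solidAngle τ r' j - solidAngle τ r j) * (r' j - r j) := by
  have h1 := T.sum_curvature_mul r' (fun i => r' i - r i)
  have h2 := T.sum_curvature_mul r (fun i => r' i - r i)
  simp only [sub_mul (_ : ℝ), Finset.sum_sub_distrib (f := fun i => T.curvature r' i * _),
    Finset.sum_sub_distrib (f := fun j => solidAngle _ r' j * _), h1, h2,
    Finset.sum_sub_distrib (f := fun τ => ∑ j ∈ τ, solidAngle τ r' j * _)]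
  ring

/-- The curvature is a monotone map. -/
theorem sum_curvature_sub_mul_nonneg {r r' : V → ℝ} (h : r ∈ T.ballPackings)
    (h' : r' ∈ T.ballPackings) :
    0 ≤ ∑ i, (T.curvature r' i - T.curvature r i) * (r' i - r i) := by
  rw [sum_curvature_sub_mul, neg_nonneg]
  exact Finset.sum_nonpos fun τ hτ => sum_solidAngle_sub_mul_nonpos (T.card_tet τ hτ)
    (T.mem_realizableRadii h hτ) (T.mem_realizableRadii h' hτ)

lemma exists_eq_mul_of_sum_curvature_sub_mul_eq_zero {r r' : V → ℝ} (h : r ∈ T.ballPackings)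
    (h' : r' ∈ T.ballPackings)
    (h0 : ∑ i, (T.curvature r' i - T.curvature r i) * (r' i - r i) = 0)
    {τ : Finset V} (hτ : τ ∈ T.tets) : ∃ c : ℝ, ∀ j ∈ τ, r' j = c * r j := by
  rw [sum_curvature_sub_mul, neg_eq_zero, Finset.sum_eq_zero_iff_of_nonpos fun τ hτ =>
    sum_solidAngle_sub_mul_nonpos (T.card_tet τ hτ) (T.mem_realizableRadii h hτ)
      (T.mem_realizableRadii h' hτ)] at h0
  exact exists_eq_mul_of_sum_solidAngle_sub_mul_eq_zero (T.card_tet τ hτ)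
    (T.mem_realizableRadii h hτ) (T.mem_realizableRadii h' hτ) (h0 τ hτ)

lemma nonempty_vertices (T : Triangulation M V) [Nonempty M] : Nonempty V := by
  obtain ⟨m⟩ := ‹Nonempty M›
  obtain ⟨x, -, hx, -⟩ := T.homeo.symm m
  by_contra hV
  rw [not_nonempty_iff] at hV
  simp at hx

/-- In a connected space, a function of the vertices that is constant on every tetrahedron is
constant. -/
theorem eq_of_forall_mem_tets [ConnectedSpace M] {A : Type*} (g : V → A)
    (hg : ∀ τ ∈ T.tets, ∀ i ∈ τ, ∀ j ∈ τ, g i = g j) (v w : V) : g v = g w := by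
  classical
  by_contra hne
  -- The total barycentric weight of the vertices with value `g v`. A tetrahedron has only such
  -- vertices or none, so this continuous function takes just the values `0` and `1`.
  set φ : geomRealization T.tets → ℝ := fun x => ∑ i with g i = g v, (x : V → ℝ) i with hφ
  have hφc : Continuous φ := by fun_prop
  have hvert : ∀ u : V, Pi.single u (1 : ℝ) ∈ geomRealization T.tets := by
    intro u
    obtain ⟨τ, hτ, hu⟩ := T.exists_tet u
    refine ⟨fun i => ?_, by simp, τ, hτ, fun i hi => ?_⟩
    · rw [Pi.single_apply]
      split_ifs <;> norm_num
    · exact Pi.single_eq_of_ne (fun e : i = u => hi (e.symm ▸ hu)) _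
  have hval : ∀ u, φ ⟨_, hvert u⟩ = if g u = g v then 1 else 0 := by
    intro u
    simp only [hφ, Pi.single_apply, Finset.sum_ite_eq', Finset.mem_filter, Finset.mem_univ,
      true_and]
  have h01 : ∀ x, φ x = 0 ∨ φ x = 1 := by
    rintro ⟨x, -, hsum, τ, hτ, hsupp⟩
    simp only [hφ]
    by_cases hv : ∃ i ∈ τ, g i = g v
    · right
      obtain ⟨i, hi, hiv⟩ := hv
      rw [← hsum, Finset.sum_filter]
      refine Finset.sum_congr rfl fun j _ => ?_
      by_cases hj : j ∈ τ
      · rw [if_pos ((hg τ hτ j hj i hi).trans hiv)]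
      · rw [hsupp j hj, ite_self]
    · left
      push Not at hv
      refine Finset.sum_eq_zero fun j hj => hsupp j fun hjτ => hv j hjτ ?_
      exact (Finset.mem_filter.mp hj).2
  obtain ⟨m, hm⟩ := mem_range_of_exists_le_of_exists_ge (c := (1 / 2 : ℝ))
    (hφc.comp T.homeo.symm.continuous)
    ⟨T.homeo ⟨_, hvert w⟩, by simp [hval, Ne.symm hne]⟩
    ⟨T.homeo ⟨_, hvert v⟩, by simp [hval]; norm_num⟩
  rcases h01 (T.homeo.symm m) with h | h <;> simp only [Function.comp_apply, h] at hm <;>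
    norm_num at hm

open Classical in
lemma differentiableAt_curvature {r : V → ℝ} (h : r ∈ T.ballPackings) (i : V) :
    DifferentiableAt ℝ (fun r => T.curvature r i) r := by
  unfold curvature
  refine (differentiableAt_const _).sub (DifferentiableAt.fun_sum fun τ hτ => ?_)
  rw [Finset.mem_filter] at hτ
  exact differentiableAt_solidAngle (T.card_tet τ hτ.1) (T.mem_realizableRadii h hτ.1) hτ.2

lemma sum_pos_of_mem_ballPackings [Nonempty V] {r : V → ℝ} (h : r ∈ T.ballPackings) :
    0 < ∑ i, r i := Finset.sum_pos (fun i _ => h.1 i) Finset.univ_nonempty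

lemma differentiableAt_crg [Nonempty V] {r : V → ℝ} (h : r ∈ T.ballPackings) :
    DifferentiableAt ℝ T.crg r := by
  have h1 := T.differentiableAt_curvature h
  have h2 : DifferentiableAt ℝ (fun r : V → ℝ => ∑ i, r i) r := by fun_prop
  have h3 : DifferentiableAt ℝ (fun r => ∑ i, T.curvature r i * r i) r := by fun_prop
  unfold crg
  simp only [div_eq_mul_inv]
  exact h3.fun_mul (h2.fun_inv (T.sum_pos_of_mem_ballPackings h).ne')

/-- The derivative of the total curvature, a consequence of the Schläfli formula. -/
lemma hasDerivAt_sum_curvature_mul {r : V → ℝ} (h : r ∈ T.ballPackings) (v : V → ℝ) :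
    HasDerivAt (fun t : ℝ => ∑ i, T.curvature (r + t • v) i * (r + t • v) i)
      (∑ i, T.curvature r i * v i) 0 := by
  have hline : ∀ i, HasDerivAt (fun t : ℝ => (r + t • v) i) (v i) 0 := fun i => by
    simpa using ((hasDerivAt_id (0 : ℝ)).smul_const (v i)).const_add (r i)
  have h0 : r + (0 : ℝ) • v = r := by simp
  have hK : ∀ i, ∃ κ : ℝ, HasDerivAt (fun t : ℝ => T.curvature (r + t • v) i) κ 0 := fun i => by
    have hd : DifferentiableAt ℝ (fun r => T.curvature r i) (r + (0 : ℝ) • v) := by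
      rw [h0]; exact T.differentiableAt_curvature h i
    exact ⟨_, (DifferentiableAt.comp (g := fun r => T.curvature r i)
      (f := fun t : ℝ => r + t • v) (0 : ℝ) hd (by fun_prop)).hasDerivAt⟩
  choose κ hκ using hK
  -- By Schläfli, the terms of the product rule that differentiate the curvatures add up to zero.
  have hS : ∑ i, κ i * r i = 0 := by
    have h1 : HasDerivAt (fun t : ℝ => ∑ i, T.curvature (r + t • v) i * r i)
        (∑ i, κ i * r i) 0 := HasDerivAt.fun_sum fun i _ => (hκ i).mul_const (r i)
    have h2 : HasDerivAt (fun t : ℝ => ∑ i, T.curvature (r + t • v) i * r i) 0 0 := by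
      simp only [T.sum_curvature_mul]
      have := (HasDerivAt.fun_sum fun τ (hτ : τ ∈ T.tets) =>
        hasDerivAt_sum_solidAngle_mul_radius (T.card_tet τ hτ)
          (T.mem_realizableRadii h hτ) v).const_sub (4 * Real.pi * ∑ i, r i)
      simpa using this
    exact h1.unique h2
  refine (HasDerivAt.fun_sum fun i _ => (hκ i).mul (hline i)).congr_deriv ?_
  rw [h0, Finset.sum_add_distrib, hS, zero_add]

/-- In the direction of the vertex `i`, the quotient rule gives a derivative proportional to `K i *
∑ r - ∑ K * r`. -/
theorem curvature_eq_crg_of_hasFDerivAt_zero [Nonempty V] {r : V → ℝ} (h : r ∈ T.ballPackings)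
    (hcrit : HasFDerivAt T.crg (0 : (V → ℝ) →L[ℝ] ℝ) r) (i : V) :
    T.curvature r i = T.crg r := by
  classical
  set v : V → ℝ := Pi.single i 1 with hv
  have h0 : r + (0 : ℝ) • v = r := by simp
  have hR := T.sum_pos_of_mem_ballPackings h
  have hline : ∀ j, HasDerivAt (fun t : ℝ => (r + t • v) j) (v j) 0 := fun j => by
    simpa using ((hasDerivAt_id (0 : ℝ)).smul_const (v j)).const_add (r j)
  have h1 : HasDerivAt (fun t : ℝ => T.crg (r + t • v)) 0 0 := by
    rw [← h0] at hcrit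
    exact (hcrit.comp_hasDerivAt (f := fun t : ℝ => r + t • v) (0 : ℝ)
      (hasDerivAt_pi.mpr hline)).congr_deriv (by simp)
  have h2 := (T.hasDerivAt_sum_curvature_mul h v).fun_div
    (HasDerivAt.fun_sum fun j (_ : j ∈ Finset.univ) => hline j) (by rw [h0]; exact hR.ne')
  have := h1.unique h2
  have e1 : ∑ j, T.curvature r j * v j = T.curvature r i := by simp [hv, Pi.single_apply]
  have e2 : ∑ j, v j = 1 := by simp [hv]
  rw [h0, e1, e2, eq_comm, div_eq_zero_iff] at this
  have := this.resolve_right (pow_pos hR 2).ne'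
  rw [crg, eq_div_iff hR.ne']
  linarith

theorem hasFDerivAt_zero_of_isLocalMinOn [Nonempty V] {r : V → ℝ} (h : r ∈ T.ballPackings)
    (hmin : IsLocalMinOn T.crg T.ballPackings r) :
    HasFDerivAt T.crg (0 : (V → ℝ) →L[ℝ] ℝ) r := by
  have h1 := (hmin.isLocalMin (T.isOpen_ballPackings.mem_nhds h)).fderiv_eq_zero
  rw [← h1]
  exact (T.differentiableAt_crg h).hasFDerivAt

lemma crg_eq_of_forall_curvature_eq [Nonempty V] {r : V → ℝ} (h : r ∈ T.ballPackings) {c : ℝ}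
    (hc : ∀ i, T.curvature r i = c) : T.crg r = c := by
  simp only [crg, hc, ← Finset.mul_sum]
  exact mul_div_cancel_right₀ c (T.sum_pos_of_mem_ballPackings h).ne'

/-- Packings of constant curvature minimize the functional. -/
theorem isMinOn_of_forall_curvature_eq [Nonempty V] {r : V → ℝ} (h : r ∈ T.ballPackings) {c : ℝ}
    (hc : ∀ i, T.curvature r i = c) : IsMinOn T.crg T.ballPackings r := by
  intro r' h'
  rw [mem_ofPred_eq, T.crg_eq_of_forall_curvature_eq h hc, crg,
    le_div_iff₀ (T.sum_pos_of_mem_ballPackings h')]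
  set X := ∑ i, (T.curvature r' i - c) * r' i with hX
  set Y := ∑ i, (T.curvature r' i - c) * r i with hY
  -- Monotonicity between `s • r` and `r'`; the curvature at `s • r` is still `c`.
  have hXY : ∀ s > 0, 0 ≤ X - s * Y := by
    intro s hs
    have := T.sum_curvature_sub_mul_nonneg (T.smul_mem_ballPackings h hs) h'
    simp only [T.curvature_smul h hs, hc] at this
    refine this.trans_eq ?_
    rw [hX, hY, Finset.mul_sum, ← Finset.sum_sub_distrib]
    exact Finset.sum_congr rfl fun i _ => by simp only [Pi.smul_apply, smul_eq_mul]; ring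
  have hX0 : 0 ≤ X := by
    -- The limit as `s` tends to zero: for `s = ε / (|Y| + 1)` the term `s * Y` is at least `-ε`.
    refine le_of_forall_pos_le_add fun ε hε => ?_
    have h1 := hXY (ε / (|Y| + 1)) (by positivity)
    have h2 : ε / (|Y| + 1) * |Y| ≤ ε := by
      rw [div_mul_eq_mul_div, div_le_iff₀ (by positivity)]
      nlinarith [abs_nonneg Y]
    have h3 : ε / (|Y| + 1) * -|Y| ≤ ε / (|Y| + 1) * Y :=
      mul_le_mul_of_nonneg_left (neg_abs_le Y) (by positivity)
    linarith
  simp only [hX, sub_mul, Finset.sum_sub_distrib, ← Finset.mul_sum] at hX0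
  linarith

open Classical in
-- The functional is a weighted mean of curvatures, and each curvature subtracts at most `4 * π` per
-- tetrahedron.
lemma bddBelow_crg [Nonempty V] : BddBelow (T.crg '' T.ballPackings) := by
  refine ⟨4 * Real.pi - T.tets.card * (4 * Real.pi), ?_⟩
  rintro _ ⟨r, h, rfl⟩
  rw [crg, le_div_iff₀ (T.sum_pos_of_mem_ballPackings h), Finset.mul_sum]
  refine Finset.sum_le_sum fun i _ => mul_le_mul_of_nonneg_right ?_ (h.1 i).le
  unfold curvature
  refine sub_le_sub_left ?_ _
  refine (Finset.sum_le_sum_of_subset_of_nonneg (Finset.filter_subset _ _)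
    fun τ _ _ => solidAngle_nonneg τ r i).trans ?_
  refine (Finset.sum_le_card_nsmul _ _ _ fun τ _ => solidAngle_le τ r i).trans_eq ?_
  rw [nsmul_eq_mul]

lemma isMinOn_iff_crg_eq [Nonempty V] {r : V → ℝ} (h : r ∈ T.ballPackings) :
    IsMinOn T.crg T.ballPackings r ↔ T.crg r = T.yamabeInvariant := by
  constructor
  · intro hmin
    have hleast : IsLeast (T.crg '' T.ballPackings) (T.crg r) := by
      refine ⟨⟨r, h, rfl⟩, ?_⟩
      rintro _ ⟨r', h', rfl⟩
      exact hmin h'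
    exact hleast.csInf_eq.symm
  · intro he r' h'
    rw [mem_ofPred_eq, he]
    exact csInf_le T.bddBelow_crg ⟨r', h', rfl⟩

/-- Packings with the same constant curvature are proportional. -/
theorem exists_eq_smul_of_curvature_eq [ConnectedSpace M] {r r' : V → ℝ}
    (h : r ∈ T.ballPackings) (h' : r' ∈ T.ballPackings)
    (hK : ∀ i, T.curvature r' i = T.curvature r i) : ∃ c : ℝ, 0 < c ∧ r' = c • r := by
  obtain ⟨v⟩ := T.nonempty_vertices
  have h0 : ∑ i, (T.curvature r' i - T.curvature r i) * (r' i - r i) = 0 := by simp [hK]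
  have hconst := T.eq_of_forall_mem_tets (fun i => r' i / r i) (fun τ hτ i hi j hj => by
    obtain ⟨c, hc⟩ := T.exists_eq_mul_of_sum_curvature_sub_mul_eq_zero h h' h0 hτ
    rw [hc i hi, hc j hj, mul_div_cancel_right₀ _ (h.1 i).ne', mul_div_cancel_right₀ _ (h.1 j).ne'])
  refine ⟨r' v / r v, div_pos (h'.1 v) (h.1 v), funext fun i => ?_⟩
  rw [Pi.smul_apply, smul_eq_mul, ← hconst i v, div_mul_cancel₀ _ (h.1 i).ne']

end Triangulation

end

/-! ### The equivalences and uniqueness up to scaling -/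

theorem theorem1p1 {M : Type*} [TopologicalSpace M] [T2Space M] [CompactSpace M]
    [ConnectedSpace M] [ChartedSpace (EuclideanSpace ℝ (Fin 3)) M]
    {V : Type*} [Fintype V] (T : Triangulation M V) :
    (T.ballPackings.Nonempty ∧ BddBelow (T.crg '' T.ballPackings)) ∧
    List.TFAE [
      ∃ r ∈ T.ballPackings, T.HasConstantCurvature r,
      ∃ r ∈ T.ballPackings, T.crg r = T.yamabeInvariant,
      ∃ r ∈ T.ballPackings, IsMinOn T.crg T.ballPackings r,
      ∃ r ∈ T.ballPackings, IsLocalMinOn T.crg T.ballPackings r,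
      ∃ r ∈ T.ballPackings, HasFDerivAt T.crg (0 : (V → ℝ) →L[ℝ] ℝ) r] ∧
    ∀ r₀ ∈ T.ballPackings, T.HasConstantCurvature r₀ →
      T.crg r₀ = T.yamabeInvariant ∧
      ∀ r : V → ℝ, (r ∈ T.ballPackings ∧ IsMinOn T.crg T.ballPackings r) ↔
        ∃ c : ℝ, 0 < c ∧ r = c • r₀ := by
  have hV : Nonempty V := T.nonempty_vertices
  refine ⟨⟨⟨_, T.one_mem_ballPackings⟩, T.bddBelow_crg⟩, ?_, ?_⟩
  · tfae_have 1 → 2 := fun ⟨r, h, c, hc⟩ =>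
      ⟨r, h, (T.isMinOn_iff_crg_eq h).mp (T.isMinOn_of_forall_curvature_eq h hc)⟩
    tfae_have 2 → 3 := fun ⟨r, h, he⟩ => ⟨r, h, (T.isMinOn_iff_crg_eq h).mpr he⟩
    tfae_have 3 → 4 := fun ⟨r, h, hmin⟩ => ⟨r, h, hmin.localize⟩
    tfae_have 4 → 5 := fun ⟨r, h, hmin⟩ => ⟨r, h, T.hasFDerivAt_zero_of_isLocalMinOn h hmin⟩
    tfae_have 5 → 1 := fun ⟨r, h, hcrit⟩ =>
      ⟨r, h, T.crg r, T.curvature_eq_crg_of_hasFDerivAt_zero h hcrit⟩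
    tfae_finish
  · rintro r₀ h₀ ⟨c₀, hc₀⟩
    have hmin₀ := T.isMinOn_of_forall_curvature_eq h₀ hc₀
    have hY := (T.isMinOn_iff_crg_eq h₀).mp hmin₀
    refine ⟨hY, fun r => ⟨?_, ?_⟩⟩
    · rintro ⟨h, hmin⟩
      have hcrit := T.hasFDerivAt_zero_of_isLocalMinOn h hmin.localize
      -- Another minimum is critical, so its curvature is constant and equal to the Yamabe
      -- invariant, which is the curvature of `r₀`.
      refine T.exists_eq_smul_of_curvature_eq h₀ h fun i => ?_
      rw [T.curvature_eq_crg_of_hasFDerivAt_zero h hcrit, (T.isMinOn_iff_crg_eq h).mp hmin, ← hY,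
        T.crg_eq_of_forall_curvature_eq h₀ hc₀, hc₀]
    · rintro ⟨c, hc, rfl⟩
      have h := T.smul_mem_ballPackings h₀ hc
      exact ⟨h, (T.isMinOn_iff_crg_eq h).mpr ((T.crg_smul h₀ hc).trans hY)⟩
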